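/- Let $(M,g)$ be a closed (compact, without boundary) connected smooth Riemannian manifold with distance function $\operatorname{dist}: M\times M\to\mathbb{R}$. Geodesics are curves $\gamma:\mathbb{R}\to M$ with $\nabla_{\dot\gamma}\dot\gamma=0$. Call $M$ an $SC$-manifold if all its geodesics are simple, periodic and of common least period: there is $L>0$ such that every unit speed geodesic $\gamma:\mathbb{R}\to M$ is periodic with least period $L$ and is injective on $[0,L)$. For a finite set $X\subset M$ with $|X|\ge 2$, let $$\mathrm{NND}(X)=\Big\{\min_{y\in X\setminus\{x\}}\operatorname{dist}(x,y)\ :\ x\in X\Big\}$$ be the set of its nearest neighbor distances, and let $\mathrm{NND}(X)=\emptyset$ if $X$ has only one point. Say that $M$ has bounded geodesic combinatorics if there is a $K\in\mathbb{N}$ such that $$|\mathrm{NND}(\{\gamma(iT)\ :\ i=0,\ldots,n\})|\le K$$ for every geodesic $\gamma:\mathbb{R}\to M$, every $T\in\mathbb{R}$ and every $n\in\mathbb{N}$. **Proposition.** Every closed Riemannian $SC$-manifold has bounded geodesic combinatorics. -/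

import Mathlib

open Bundle
open scoped Manifold ContDiff

noncomputable section

section NearestNeighbors

variable {X : Type*} [MetricSpace X]

/-- The set of all nearest neighbor distances of `S`: the numbers `min_{y ∈ S \ {x}} dist x y`,
for `x ∈ S`. (For a one-point set there are no such minima, and the set is empty.) -/
def nearestNeighborDistances (S : Set X) : Set ℝ :=
  {r | ∃ x ∈ S, IsLeast ((fun y => dist x y) '' (S \ {x})) r}

end NearestNeighbors

section Geodesics

variable (E : Type*) [NormedAddCommGroup E] [NormedSpace ℝ E]
  {M : Type*} [TopologicalSpace M] [ChartedSpace E M]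
  [RiemannianBundle (fun x : M => TangentSpace 𝓘(ℝ, E) x)]

/-- The Riemannian metric in the coordinates of the chart around `a`: the inner product, at the
point of `M` with coordinates `y`, of the tangent vectors with coordinates `v` and `w`. -/
def coordMetric (a : M) (y v w : E) : ℝ :=
  inner ℝ (mfderiv 𝓘(ℝ, E) 𝓘(ℝ, E) (extChartAt 𝓘(ℝ, E) a).symm y v)
    (mfderiv 𝓘(ℝ, E) 𝓘(ℝ, E) (extChartAt 𝓘(ℝ, E) a).symm y w)

/-- The Christoffel symbols of the first kind of the Levi-Civita connection, in the chart
around `a` and without choosing a basis: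
`[u v, w] = 1/2 (∂_u g(v, w) + ∂_v g(u, w) - ∂_w g(u, v))` at the point with coordinates `y`. -/
def christoffelFirst (a : M) (y u v w : E) : ℝ :=
  (fderiv ℝ (fun z => coordMetric E a z v w) y u + fderiv ℝ (fun z => coordMetric E a z u w) y v
    - fderiv ℝ (fun z => coordMetric E a z u v) y w) / 2

/-- `γ : ℝ → M` is a geodesic: it is `C²` and its covariant acceleration with respect to the
Levi-Civita connection vanishes. In a chart, with `c` the coordinate expression of `γ`, this is
the geodesic equation `c'' + Γ(c', c') = 0`, here paired by the metric with an arbitrary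
vector `w`. Constant curves and geodesics of any constant speed are included. -/
def IsGeodesic (γ : ℝ → M) : Prop :=
  ContMDiff 𝓘(ℝ, ℝ) 𝓘(ℝ, E) 2 γ ∧
    ∀ (a : M) (t : ℝ), γ t ∈ (extChartAt 𝓘(ℝ, E) a).source → ∀ w : E,
      let c : ℝ → E := fun s => extChartAt 𝓘(ℝ, E) a (γ s)
      coordMetric E a (c t) (deriv (deriv c) t) w
        + christoffelFirst E a (c t) (deriv c t) (deriv c t) w = 0

/-- `γ` is parametrized by arc length. -/
def IsUnitSpeed (γ : ℝ → M) : Prop :=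
  ∀ t : ℝ, ‖mfderiv 𝓘(ℝ, ℝ) 𝓘(ℝ, E) γ t (1 : ℝ)‖ = 1

variable (M) in
/-- The `SC` condition: there is `L > 0` such that every (unit speed) geodesic is periodic with
least period `L` and simple, that is, without self-intersections within one period. -/
def IsSC : Prop :=
  ∃ L : ℝ, 0 < L ∧ ∀ γ : ℝ → M, IsGeodesic E γ → IsUnitSpeed E γ →
    IsLeast {P : ℝ | 0 < P ∧ Function.Periodic γ P} L ∧ Set.InjOn γ (Set.Ico 0 L)

end Geodesics

section Combinatorics

variable (E : Type*) [NormedAddCommGroup E] [NormedSpace ℝ E]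
  (M : Type*) [MetricSpace M] [ChartedSpace E M]
  [RiemannianBundle (fun x : M => TangentSpace 𝓘(ℝ, E) x)]

/-- `K`-bounded geodesic combinatorics: equally spaced points `γ(0), γ(T), …, γ(nT)` along a
geodesic have at most `K` distinct nearest neighbor distances. -/
def HasKBoundedGeodesicCombinatorics (K : ℕ) : Prop :=
  ∀ γ : ℝ → M, IsGeodesic E γ → ∀ (T : ℝ) (n : ℕ),
    (nearestNeighborDistances {p : M | ∃ i : ℕ, i ≤ n ∧ p = γ (i * T)}).encard ≤ K

/-- Bounded geodesic combinatorics: `K`-bounded geodesic combinatorics for some `K`. -/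
def HasBoundedGeodesicCombinatorics : Prop :=
  ∃ K : ℕ, HasKBoundedGeodesicCombinatorics E M K

end Combinatorics

end

/-! Distances along a geodesic are understood only at short range, but nearest neighbors in a long
progression are at short range. Let `L` be the common period. By compactness there are `r > 0` and
`ε > 0`, with `ε ≤ r` after shrinking, that serve all unit speed geodesics: parameters at distance
at most `r` in `AddCircle L` give points at exactly that distance (`exists_uniform_minimizing`), and
parameters at distance at least `r` give points at distance at least `ε`
(`exists_uniform_separation`).

The rest happens on the circle. Let `τ` be the class of `T` and `N > L / ε`. By Dirichlet, some `k ≤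
N` has `‖k • τ‖ < ε`. Short progressions, and the case `k • τ = 0`, leave at most `2 * N` points.
Otherwise every nearest neighbor distance is below `ε`, so that of index `i` is the least positive
`‖q • τ‖` with `1 ≤ q ≤ max i (n - i)`. As in the three gap theorem, these minima take at most three
values (`encard_least_norm_nsmul_le`).

Minimization is proved without the exponential map: the energy of a competitor in a chart is
expanded to second order about the geodesic. The first variation integrates to zero, and coercivity
absorbs the quadratic error when the geodesic is short (`MetricBounds.energy_ge`). Separation is by
contradiction: an ultrafilter limit of counterexamples is again a unit speed geodesic
(`isGeodesic_of_tendsto`), but with a self-intersection. -/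

open Set Filter Topology

/-! ### The metric in a chart -/

section ChartMetric

variable {E : Type*} [NormedAddCommGroup E] [NormedSpace ℝ E]
  {M : Type*} [TopologicalSpace M] [ChartedSpace E M]
  [RiemannianBundle (fun x : M => TangentSpace 𝓘(ℝ, E) x)]

theorem coordMetric_symm (a : M) (y v w : E) : coordMetric E a y v w = coordMetric E a y w v :=
  real_inner_comm _ _

/-- The Riemannian metric in a chart, as a continuous bilinear form. -/
noncomputable def chartMetric [FiniteDimensional ℝ E] (a : M) (y : E) : E →L[ℝ] E →L[ℝ] ℝ :=
  LinearMap.toContinuousLinearMap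
    ((LinearMap.toContinuousLinearMap (𝕜 := ℝ) (E := E) (F' := ℝ)).toLinearMap ∘ₗ
      LinearMap.mk₂ ℝ (fun v w : E => coordMetric E a y v w)
        (fun v v' w => by
          let D := mfderiv 𝓘(ℝ, E) 𝓘(ℝ, E) (extChartAt 𝓘(ℝ, E) a).symm y
          have h : D (v + v') = D v + D v' := map_add D v v'
          change inner ℝ (D (v + v')) (D w) = _
          rw [h]
          exact inner_add_left _ _ _)
        (fun r v w => by
          let D := mfderiv 𝓘(ℝ, E) 𝓘(ℝ, E) (extChartAt 𝓘(ℝ, E) a).symm y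
          have h : D (r • v) = r • D v := map_smul D r v
          change inner ℝ (D (r • v)) (D w) = _
          rw [h]
          exact real_inner_smul_left _ _ _)
        (fun v w w' => by
          let D := mfderiv 𝓘(ℝ, E) 𝓘(ℝ, E) (extChartAt 𝓘(ℝ, E) a).symm y
          have h : D (w + w') = D w + D w' := map_add D w w'
          change inner ℝ (D v) (D (w + w')) = _
          rw [h]
          exact inner_add_right _ _ _)
        (fun r v w => by
          let D := mfderiv 𝓘(ℝ, E) 𝓘(ℝ, E) (extChartAt 𝓘(ℝ, E) a).symm y
          have h : D (r • w) = r • D w := map_smul D r w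
          change inner ℝ (D v) (D (r • w)) = _
          rw [h]
          exact real_inner_smul_right _ _ _))

@[simp] theorem chartMetric_apply [FiniteDimensional ℝ E] (a : M) (y v w : E) :
    chartMetric a y v w = coordMetric E a y v w := rfl

omit [RiemannianBundle (fun x : M => TangentSpace 𝓘(ℝ, E) x)] in
theorem mdifferentiableAt_extChartAt_symm' [IsManifold 𝓘(ℝ, E) ∞ M] (a : M) {y : E}
    (hy : y ∈ (extChartAt 𝓘(ℝ, E) a).target) :
    MDifferentiableAt 𝓘(ℝ, E) 𝓘(ℝ, E) (extChartAt 𝓘(ℝ, E) a).symm y :=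
  (((contMDiffOn_extChartAt_symm (n := ∞) a) y hy).contMDiffAt
    ((isOpen_extChartAt_target a).mem_nhds hy)).mdifferentiableAt (by simp)

/-- The coordinate fields are smooth along the inverse chart, being its tangent map applied to
constant fields; smoothness of the bundle metric does the rest. -/
theorem contDiffOn_coordMetric [IsManifold 𝓘(ℝ, E) ∞ M]
    [IsContMDiffRiemannianBundle 𝓘(ℝ, E) ∞ E (fun x : M => TangentSpace 𝓘(ℝ, E) x)]
    (a : M) (v w : E) :
    ContDiffOn ℝ ∞ (fun y => coordMetric E a y v w) (extChartAt 𝓘(ℝ, E) a).target := by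
  have key : ∀ v : E, ContMDiffOn 𝓘(ℝ, E) (𝓘(ℝ, E).prod 𝓘(ℝ, E)) ∞
      (fun y : E => (⟨(extChartAt 𝓘(ℝ, E) a).symm y,
        mfderiv 𝓘(ℝ, E) 𝓘(ℝ, E) (extChartAt 𝓘(ℝ, E) a).symm y v⟩ :
        TotalSpace E (fun x : M => TangentSpace 𝓘(ℝ, E) x)))
      (extChartAt 𝓘(ℝ, E) a).target := by
    intro v
    have h1 := (contMDiffOn_extChartAt_symm (I := 𝓘(ℝ, E)) (n := ∞) a)
    have h2 := h1.contMDiffOn_tangentMapWithin (m := ∞) (by simp)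
      (isOpen_extChartAt_target a).uniqueMDiffOn
    have h3 : ContMDiff 𝓘(ℝ, E) (𝓘(ℝ, E).prod 𝓘(ℝ, E)) ∞
      (fun y : E => (⟨y, v⟩ : TangentBundle 𝓘(ℝ, E) E)) := by
      intro y
      rw [Bundle.contMDiffAt_totalSpace]
      refine ⟨contMDiffAt_id, ?_⟩
      simpa using contMDiffAt_const
    have h4 := h2.comp (h3.contMDiffOn (s := (extChartAt 𝓘(ℝ, E) a).target)) (fun y hy => hy)
    refine h4.congr fun y hy => ?_
    simp only [Function.comp, tangentMapWithin]
    rw [mfderivWithin_of_isOpen (isOpen_extChartAt_target a) hy]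
  rw [← contMDiffOn_iff_contDiffOn]
  exact ContMDiffOn.inner_bundle (E := fun x : M => TangentSpace 𝓘(ℝ, E) x)
    (b := (extChartAt 𝓘(ℝ, E) a).symm) (key v) (key w)

theorem contDiffOn_chartMetric [FiniteDimensional ℝ E] [IsManifold 𝓘(ℝ, E) ∞ M]
    [IsContMDiffRiemannianBundle 𝓘(ℝ, E) ∞ E (fun x : M => TangentSpace 𝓘(ℝ, E) x)]
    (a : M) : ContDiffOn ℝ ∞ (chartMetric (E := E) a) (extChartAt 𝓘(ℝ, E) a).target := by
  rw [contDiffOn_clm_apply]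
  intro v
  rw [contDiffOn_clm_apply]
  intro w
  exact contDiffOn_coordMetric a v w

/-- The chart composed with its inverse is the identity near `y`, so by the chain rule the
derivative of the inverse chart is injective. -/
theorem coordMetric_self_pos [IsManifold 𝓘(ℝ, E) ∞ M] (a : M) {y : E}
    (hy : y ∈ (extChartAt 𝓘(ℝ, E) a).target) {v : E} (hv : v ≠ 0) :
    0 < coordMetric E a y v v := by
  refine real_inner_self_pos.2 fun h => hv ?_
  have h1 := mdifferentiableAt_extChartAt_symm' a hy
  have hx : (extChartAt 𝓘(ℝ, E) a).symm y ∈ (chartAt E a).source := by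
    simpa using (extChartAt 𝓘(ℝ, E) a).map_target hy
  have h2 : MDifferentiableAt 𝓘(ℝ, E) 𝓘(ℝ, E) (extChartAt 𝓘(ℝ, E) a)
      ((extChartAt 𝓘(ℝ, E) a).symm y) := mdifferentiableAt_extChartAt hx
  have h3 : mfderiv 𝓘(ℝ, E) 𝓘(ℝ, E) (extChartAt 𝓘(ℝ, E) a ∘ (extChartAt 𝓘(ℝ, E) a).symm) y =
      mfderiv 𝓘(ℝ, E) 𝓘(ℝ, E) (id : E → E) y := by
    apply EventuallyEq.mfderiv_eq
    filter_upwards [(isOpen_extChartAt_target a).mem_nhds hy] with z hz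
    exact (extChartAt 𝓘(ℝ, E) a).right_inv hz
  rw [mfderiv_comp y h2 h1, mfderiv_id] at h3
  have h4 := congrArg (fun L : TangentSpace 𝓘(ℝ, E) y →L[ℝ] TangentSpace 𝓘(ℝ, E) y => L v) h3
  have h5 : (mfderiv 𝓘(ℝ, E) 𝓘(ℝ, E) (extChartAt 𝓘(ℝ, E) a) ((extChartAt 𝓘(ℝ, E) a).symm y))
    ((mfderiv 𝓘(ℝ, E) 𝓘(ℝ, E) (extChartAt 𝓘(ℝ, E) a).symm y) v) = v := h4
  rw [h] at h5
  rw [← h5]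
  exact map_zero _

end ChartMetric

/-! ### Curves in a chart -/

section ChartCurves

variable {E : Type*} [NormedAddCommGroup E] [NormedSpace ℝ E]
  {M : Type*} [TopologicalSpace M] [ChartedSpace E M]
  [RiemannianBundle (fun x : M => TangentSpace 𝓘(ℝ, E) x)]

/-- All tangent spaces are definitionally `E`, but their inner products depend on the base point;
this changes the base point without a dependent rewrite. -/
theorem inner_tangentSpace_congr {x y : M} (h : x = y) (u : E) :
    inner ℝ (show TangentSpace 𝓘(ℝ, E) x from u) (show TangentSpace 𝓘(ℝ, E) x from u) =
      inner ℝ (show TangentSpace 𝓘(ℝ, E) y from u) (show TangentSpace 𝓘(ℝ, E) y from u) := by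
  subst h; rfl

/-- The square of the speed of a curve is the coordinate metric evaluated at its coordinate
velocity. -/
theorem norm_mfderivWithin_sq [IsManifold 𝓘(ℝ, E) ∞ M] (a : M) {σ : ℝ → M} {s : Set ℝ} {t : ℝ}
    (hσ : MDifferentiableWithinAt 𝓘(ℝ, ℝ) 𝓘(ℝ, E) σ s t)
    (ht : σ t ∈ (extChartAt 𝓘(ℝ, E) a).source) {v : E}
    (hv : HasDerivWithinAt (fun u => extChartAt 𝓘(ℝ, E) a (σ u)) v s t)
    (hs : UniqueDiffWithinAt ℝ s t) :
    ‖mfderivWithin 𝓘(ℝ, ℝ) 𝓘(ℝ, E) σ s t (1 : ℝ)‖ ^ 2 =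
      coordMetric E a (extChartAt 𝓘(ℝ, E) a (σ t)) v v := by
  have hx : σ t ∈ (chartAt E a).source := by simpa using ht
  have h2 : MDifferentiableAt 𝓘(ℝ, E) 𝓘(ℝ, E) (extChartAt 𝓘(ℝ, E) a) (σ t) :=
    mdifferentiableAt_extChartAt hx
  have h3 := h2.hasMFDerivAt.comp_hasMFDerivWithinAt t hσ.hasMFDerivWithinAt
  have h4 : HasFDerivWithinAt (fun u => extChartAt 𝓘(ℝ, E) a (σ u))
      (show ℝ →L[ℝ] E from (mfderiv 𝓘(ℝ, E) 𝓘(ℝ, E) (extChartAt 𝓘(ℝ, E) a) (σ t)).comp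
        (mfderivWithin 𝓘(ℝ, ℝ) 𝓘(ℝ, E) σ s t)) s t := h3.hasFDerivWithinAt
  have h5 := hs.eq_deriv _ hv h4.hasDerivWithinAt
  have h6 := mfderivWithin_extChartAt_symm_comp_mfderiv_extChartAt' (I := 𝓘(ℝ, E)) ht
  have hr : range (𝓘(ℝ, E) : E → E) = univ := by simp
  rw [hr, mfderivWithin_univ] at h6
  have h7 : (mfderiv 𝓘(ℝ, E) 𝓘(ℝ, E) (extChartAt 𝓘(ℝ, E) a).symm
      (extChartAt 𝓘(ℝ, E) a (σ t)) : E → E) v =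
      mfderivWithin 𝓘(ℝ, ℝ) 𝓘(ℝ, E) σ s t (1 : ℝ) := by
    rw [h5]
    exact congrArg (fun L : TangentSpace 𝓘(ℝ, E) (σ t) →L[ℝ] TangentSpace 𝓘(ℝ, E) (σ t) =>
      L (mfderivWithin 𝓘(ℝ, ℝ) 𝓘(ℝ, E) σ s t (1 : ℝ))) h6
  rw [← real_inner_self_eq_norm_sq]
  have h8 := inner_tangentSpace_congr (E := E) ((extChartAt 𝓘(ℝ, E) a).left_inv ht)
    (mfderivWithin 𝓘(ℝ, ℝ) 𝓘(ℝ, E) σ s t (1 : ℝ))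
  refine h8.symm.trans ?_
  rw [coordMetric]
  have h9 : ∀ u : E, (mfderiv 𝓘(ℝ, E) 𝓘(ℝ, E) (extChartAt 𝓘(ℝ, E) a).symm
      (extChartAt 𝓘(ℝ, E) a (σ t)) : E → E) v = u →
      inner ℝ (show TangentSpace 𝓘(ℝ, E) ((extChartAt 𝓘(ℝ, E) a).symm
        (extChartAt 𝓘(ℝ, E) a (σ t))) from u) (show TangentSpace 𝓘(ℝ, E)
        ((extChartAt 𝓘(ℝ, E) a).symm (extChartAt 𝓘(ℝ, E) a (σ t))) from u) =
      inner ℝ (mfderiv 𝓘(ℝ, E) 𝓘(ℝ, E) (extChartAt 𝓘(ℝ, E) a).symm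
        (extChartAt 𝓘(ℝ, E) a (σ t)) v) (mfderiv 𝓘(ℝ, E) 𝓘(ℝ, E) (extChartAt 𝓘(ℝ, E) a).symm
        (extChartAt 𝓘(ℝ, E) a (σ t)) v) := by
    rintro u rfl; rfl
  exact h9 _ h7

theorem norm_mfderiv_sq [IsManifold 𝓘(ℝ, E) ∞ M] (a : M) {σ : ℝ → M} {t : ℝ}
    (hσ : MDifferentiableAt 𝓘(ℝ, ℝ) 𝓘(ℝ, E) σ t)
    (ht : σ t ∈ (extChartAt 𝓘(ℝ, E) a).source) {v : E}
    (hv : HasDerivAt (fun u => extChartAt 𝓘(ℝ, E) a (σ u)) v t) :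
    ‖mfderiv 𝓘(ℝ, ℝ) 𝓘(ℝ, E) σ t (1 : ℝ)‖ ^ 2 =
      coordMetric E a (extChartAt 𝓘(ℝ, E) a (σ t)) v v := by
  have := norm_mfderivWithin_sq a (s := univ) (mdifferentiableWithinAt_univ.2 hσ) ht
    hv.hasDerivWithinAt uniqueDiffWithinAt_univ
  rwa [mfderivWithin_univ] at this

omit [RiemannianBundle (fun x : M => TangentSpace 𝓘(ℝ, E) x)] in
theorem contDiffAt_extChartAt_comp [IsManifold 𝓘(ℝ, E) ∞ M] (a : M) {σ : ℝ → M} {t : ℝ} {n : ℕ∞}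
    (hσ : ContMDiffAt 𝓘(ℝ, ℝ) 𝓘(ℝ, E) n σ t)
    (ht : σ t ∈ (extChartAt 𝓘(ℝ, E) a).source) :
    ContDiffAt ℝ n (fun u => extChartAt 𝓘(ℝ, E) a (σ u)) t := by
  have hx : σ t ∈ (chartAt E a).source := by simpa using ht
  have : IsManifold 𝓘(ℝ, E) n M := IsManifold.of_le (n := ∞) (by exact_mod_cast le_top)
  exact (contMDiffAt_iff_target_of_mem_source (n := n) hx).1 hσ |>.2.contDiffAt

omit [RiemannianBundle (fun x : M => TangentSpace 𝓘(ℝ, E) x)] in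
theorem contDiffWithinAt_extChartAt_comp [IsManifold 𝓘(ℝ, E) ∞ M] (a : M) {σ : ℝ → M}
    {s : Set ℝ} {t : ℝ} {n : ℕ∞} (hσ : ContMDiffWithinAt 𝓘(ℝ, ℝ) 𝓘(ℝ, E) n σ s t)
    (ht : σ t ∈ (extChartAt 𝓘(ℝ, E) a).source) :
    ContDiffWithinAt ℝ n (fun u => extChartAt 𝓘(ℝ, E) a (σ u)) s t := by
  have hx : σ t ∈ (chartAt E a).source := by simpa using ht
  have : IsManifold 𝓘(ℝ, E) n M := IsManifold.of_le (n := ∞) (by exact_mod_cast le_top)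
  exact (contMDiffWithinAt_iff_target_of_mem_source (n := n) hx).1 hσ |>.2.contDiffWithinAt

end ChartCurves

/-! ### Quantitative control of a variable inner product -/

section MetricBounds

variable {E : Type*} [NormedAddCommGroup E] [NormedSpace ℝ E]

/-! Shortcut instances on spaces of multilinear forms, for which instance search through the
Riemannian bundle instances of the scope `Bundle` is expensive. -/

noncomputable instance bilinearNormedAddCommGroup : NormedAddCommGroup (E →L[ℝ] E →L[ℝ] ℝ) :=
  ContinuousLinearMap.toNormedAddCommGroup

noncomputable instance bilinearSeminormedAddCommGroup : SeminormedAddCommGroup (E →L[ℝ] E →L[ℝ] ℝ) :=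
  ContinuousLinearMap.toSeminormedAddCommGroup

noncomputable instance bilinearNormedSpace : NormedSpace ℝ (E →L[ℝ] E →L[ℝ] ℝ) :=
  ContinuousLinearMap.toNormedSpace

noncomputable instance bilinearAddCommGroup : AddCommGroup (E →L[ℝ] E →L[ℝ] ℝ) :=
  ContinuousLinearMap.addCommGroup

noncomputable instance trilinearNormedAddCommGroup : NormedAddCommGroup (E →L[ℝ] E →L[ℝ] E →L[ℝ] ℝ) :=
  ContinuousLinearMap.toNormedAddCommGroup

noncomputable instance trilinearSeminormedAddCommGroup : SeminormedAddCommGroup (E →L[ℝ] E →L[ℝ] E →L[ℝ] ℝ) :=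
  ContinuousLinearMap.toSeminormedAddCommGroup

noncomputable instance trilinearNormedSpace : NormedSpace ℝ (E →L[ℝ] E →L[ℝ] E →L[ℝ] ℝ) :=
  ContinuousLinearMap.toNormedSpace

noncomputable instance trilinearAddCommGroup : AddCommGroup (E →L[ℝ] E →L[ℝ] E →L[ℝ] ℝ) :=
  ContinuousLinearMap.addCommGroup

/-- Quantitative control, on a set `s`, of a variable inner product `G` and of its first
derivative: coercivity with constant `lam`, and Lipschitz and Taylor bounds with constant `C`. -/
structure MetricBounds (G : E → E →L[ℝ] E →L[ℝ] ℝ) (s : Set E) (lam C : ℝ) : Prop where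
  lam_pos : 0 < lam
  nonneg : 0 ≤ C
  coercive : ∀ y ∈ s, ∀ v, lam * ‖v‖ ^ 2 ≤ G y v v
  symm : ∀ y ∈ s, ∀ v w, G y v w = G y w v
  differentiableAt : ∀ y ∈ s, DifferentiableAt ℝ G y
  lip : ∀ y ∈ s, ∀ z ∈ s, ‖G z - G y‖ ≤ C * ‖z - y‖
  fderiv_bound : ∀ y ∈ s, ‖fderiv ℝ G y‖ ≤ C
  fderiv_lip : ∀ y ∈ s, ∀ z ∈ s, ‖fderiv ℝ G z - fderiv ℝ G y‖ ≤ C * ‖z - y‖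
  taylor : ∀ y ∈ s, ∀ z ∈ s, ‖G z - G y - fderiv ℝ G y (z - y)‖ ≤ C * ‖z - y‖ ^ 2

/-- Coercivity comes from compactness of `s` times the unit sphere and homogeneity. `C` bounds the
first two derivatives on `s`; by convexity the mean value inequality turns this into the Lipschitz
and Taylor bounds. -/
theorem exists_metricBounds [FiniteDimensional ℝ E] {G : E → E →L[ℝ] E →L[ℝ] ℝ} {U : Set E}
    (hU : IsOpen U) (hG : ContDiffOn ℝ ∞ G U) (hsymm : ∀ y ∈ U, ∀ v w, G y v w = G y w v)
    (hpos : ∀ y ∈ U, ∀ v, v ≠ 0 → 0 < G y v v) {s : Set E} (hsU : s ⊆ U) (hs : IsCompact s)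
    (hconv : Convex ℝ s) : ∃ lam C : ℝ, MetricBounds G s lam C := by
  have := FiniteDimensional.proper_real E
  have hdG : ContDiffOn ℝ ∞ (fderiv ℝ G) U := hG.fderiv_of_isOpen hU (by simp)
  have hddG : ContDiffOn ℝ ∞ (fderiv ℝ (fderiv ℝ G)) U := hdG.fderiv_of_isOpen hU (by simp)
  obtain ⟨C1, hC1⟩ := hs.exists_bound_of_continuousOn (hdG.continuousOn.mono hsU)
  obtain ⟨C2, hC2⟩ := hs.exists_bound_of_continuousOn (hddG.continuousOn.mono hsU)
  obtain ⟨lam, hlam, hlam'⟩ : ∃ lam : ℝ, 0 < lam ∧ ∀ p ∈ s ×ˢ Metric.sphere (0 : E) 1,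
      lam ≤ G p.1 p.2 p.2 := by
    refine (hs.prod (isCompact_sphere (0 : E) 1)).exists_forall_le' ?_ ?_
    · have h1 : ContinuousOn (fun p : E × E => G p.1) (s ×ˢ Metric.sphere (0 : E) 1) :=
        (hG.continuousOn.mono hsU).comp continuousOn_fst fun p hp => hp.1
      exact (h1.clm_apply continuousOn_snd).clm_apply continuousOn_snd
    · rintro ⟨y, v⟩ ⟨hy, hv⟩
      refine hpos y (hsU hy) v ?_
      rintro rfl
      simp at hv
  have hdiff : ∀ y ∈ s, DifferentiableAt ℝ G y := fun y hy =>
    (hG.differentiableOn (by simp)).differentiableAt (hU.mem_nhds (hsU hy))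
  have hdiff' : ∀ y ∈ s, DifferentiableAt ℝ (fderiv ℝ G) y := fun y hy =>
    (hdG.differentiableOn (by simp)).differentiableAt (hU.mem_nhds (hsU hy))
  have hC : ∀ y ∈ s, ‖fderiv ℝ G y‖ ≤ max (max C1 C2) 0 := fun y hy =>
    (hC1 y hy).trans ((le_max_left _ _).trans (le_max_left _ _))
  have hC' : ∀ y ∈ s, ‖fderiv ℝ (fderiv ℝ G) y‖ ≤ max (max C1 C2) 0 := fun y hy =>
    (hC2 y hy).trans ((le_max_right _ _).trans (le_max_left _ _))
  have hlip' : ∀ y ∈ s, ∀ z ∈ s,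
      ‖fderiv ℝ G z - fderiv ℝ G y‖ ≤ max (max C1 C2) 0 * ‖z - y‖ := fun y hy z hz =>
    hconv.norm_image_sub_le_of_norm_fderiv_le hdiff' hC' hy hz
  refine ⟨lam, max (max C1 C2) 0, hlam, le_max_right _ _, ?_, fun y hy => hsymm y (hsU hy),
    hdiff, fun y hy z hz => hconv.norm_image_sub_le_of_norm_fderiv_le hdiff hC hy hz, hC,
    hlip', ?_⟩
  · intro y hy v
    rcases eq_or_ne v 0 with rfl | hv
    · simp
    have hv' : 0 < ‖v‖ := norm_pos_iff.2 hv
    have h := hlam' (y, ‖v‖⁻¹ • v) ⟨hy, by simp [norm_smul, hv'.ne']⟩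
    simp only [map_smul, smul_apply, smul_eq_mul] at h
    have h2 : lam * ‖v‖ ^ 2 ≤ (‖v‖⁻¹ * (‖v‖⁻¹ * G y v v)) * ‖v‖ ^ 2 := by gcongr
    have h3 : (‖v‖⁻¹ * (‖v‖⁻¹ * G y v v)) * ‖v‖ ^ 2 = G y v v := by field_simp
    rwa [h3] at h2
  · intro y hy z hz
    have hsub : segment ℝ y z ⊆ s := hconv.segment_subset hy hz
    have h := (convex_segment (𝕜 := ℝ) y z).norm_image_sub_le_of_norm_hasFDerivWithin_le'
      (f := G) (f' := fderiv ℝ G) (φ := fderiv ℝ G y) (C := max (max C1 C2) 0 * ‖z - y‖)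
      (fun x hx => (hdiff x (hsub hx)).hasFDerivAt.hasFDerivWithinAt)
      (fun x hx => (hlip' y hy x (hsub hx)).trans ?_) (left_mem_segment ℝ y z)
      (right_mem_segment ℝ y z)
    · rwa [mul_assoc, ← sq] at h
    · gcongr
      have := norm_sub_le_of_mem_segment hx
      simpa [norm_sub_rev] using this

namespace MetricBounds

variable {G : E → E →L[ℝ] E →L[ℝ] ℝ} {s : Set E} {lam C : ℝ}

theorem abs_le_of_norm_le (L : E →L[ℝ] E →L[ℝ] ℝ) {K : ℝ} (hL : ‖L‖ ≤ K) (v w : E) :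
    |L v w| ≤ K * ‖v‖ * ‖w‖ := by
  rw [← Real.norm_eq_abs]
  exact (L.le_opNorm₂ v w).trans (by gcongr)

theorem norm_sq_le (hG : MetricBounds G s lam C) {y p : E} (hy : y ∈ s) (hp : G y p p = 1) :
    ‖p‖ ^ 2 ≤ 1 / lam := by
  rw [le_div_iff₀ hG.lam_pos, mul_comm, ← hp]
  exact hG.coercive y hy p

/-- The second order lower bound of the energy density around a unit vector. -/
theorem energy_density_ge (hG : MetricBounds G s lam C) {y z p q : E} {θ a : ℝ}
    (hy : y ∈ s) (hz : z ∈ s) (hp : G y p p = 1) (hθ : 0 ≤ θ) :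
    θ ^ 2 * (1 + fderiv ℝ G y (z - y) p p) + 2 * θ * G y p (q - θ • p)
      + lam * a * θ * ‖q - θ • p‖ - lam / 2 * a ^ 2 * θ ^ 2
      - (2 * C ^ 2 / lam ^ 2 + C / lam) * θ ^ 2 * ‖z - y‖ ^ 2 ≤ G z q q := by
  obtain ⟨k, hk⟩ : ∃ k, k = q - θ • p := ⟨_, rfl⟩
  have hq : q = θ • p + k := by rw [hk]; abel
  rw [← hk]
  have hexp : G z q q = θ ^ 2 * G z p p + 2 * θ * G z p k + G z k k := by
    rw [hq]
    simp only [map_add, map_smul, add_apply, smul_apply, smul_eq_mul]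
    rw [hG.symm z hz k p]
    ring
  have hP := hG.norm_sq_le hy hp
  have hl := hG.lam_pos
  have hC := hG.nonneg
  have e1 := abs_le_of_norm_le _ (hG.taylor y hy z hz) p p
  have e2 := abs_le_of_norm_le _ (hG.lip y hy z hz) p k
  have e3 := hG.coercive z hz k
  simp only [sub_apply] at e1 e2
  have e1' := (abs_le.1 e1).1
  have e2' := (abs_le.1 e2).1
  rw [hp] at e1'
  generalize ‖z - y‖ = hn at *
  generalize ‖k‖ = kn at *
  generalize ‖p‖ = P at *
  have f1 : θ ^ 2 * (C * hn ^ 2 * P * P) ≤ θ ^ 2 * (C / lam * hn ^ 2) := by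
    have : C * hn ^ 2 * P * P ≤ C / lam * hn ^ 2 := by
      calc C * hn ^ 2 * P * P = C * hn ^ 2 * P ^ 2 := by ring
        _ ≤ C * hn ^ 2 * (1 / lam) := by gcongr
        _ = C / lam * hn ^ 2 := by ring
    gcongr
  -- Young's inequality spends half of the coercive term `lam * kn ^ 2` on the cross term.
  have f2 : 2 * θ * (C * hn * P * kn) ≤ lam / 2 * kn ^ 2 + 2 / lam * (θ * C * hn * P) ^ 2 := by
    have h0 : 0 ≤ 2 / lam * (lam / 2 * kn - θ * C * hn * P) ^ 2 := by positivity
    have h1 : 2 / lam * (lam / 2 * kn - θ * C * hn * P) ^ 2 = lam / 2 * kn ^ 2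
        + 2 / lam * (θ * C * hn * P) ^ 2 - 2 * θ * (C * hn * P * kn) := by
      field_simp
      ring
    linarith
  have f3 : 2 / lam * (θ * C * hn * P) ^ 2 ≤ 2 * C ^ 2 / lam ^ 2 * θ ^ 2 * hn ^ 2 := by
    calc 2 / lam * (θ * C * hn * P) ^ 2 = 2 / lam * (θ * C * hn) ^ 2 * P ^ 2 := by ring
      _ ≤ 2 / lam * (θ * C * hn) ^ 2 * (1 / lam) := by gcongr
      _ = 2 * C ^ 2 / lam ^ 2 * θ ^ 2 * hn ^ 2 := by field_simp
  -- The other half is replaced by its tangent line at `kn = a * θ`, so that only the integral of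
  -- `‖k‖` matters later.
  have f4 : lam * a * θ * kn - lam / 2 * a ^ 2 * θ ^ 2 ≤ lam / 2 * kn ^ 2 := by
    have : 0 ≤ lam / 2 * (kn - a * θ) ^ 2 := by positivity
    linarith [this, (by ring : lam / 2 * (kn - a * θ) ^ 2 =
      lam / 2 * kn ^ 2 - lam * a * θ * kn + lam / 2 * a ^ 2 * θ ^ 2)]
  have g1 := mul_le_mul_of_nonneg_left e1' (sq_nonneg θ)
  have g2 := mul_le_mul_of_nonneg_left e2' (by positivity : 0 ≤ 2 * θ)
  rw [hexp]
  linarith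

end MetricBounds

end MetricBounds

/-! ### Short geodesics against nearby curves: energy and length -/

section EnergyComparison

variable {E : Type*} [NormedAddCommGroup E] [NormedSpace ℝ E]

namespace MetricBounds

variable {G : E → E →L[ℝ] E →L[ℝ] ℝ} {s : Set E} {lam C : ℝ}

theorem continuousOn (hG : MetricBounds G s lam C) : ContinuousOn G s :=
  fun y hy => (hG.differentiableAt y hy).continuousAt.continuousWithinAt

/-- The first variation formula: along a reparametrized geodesic `c ∘ Θ`, the derivative of
`2 G(c', h)` is the first variation of the energy density in the direction `h`. -/
theorem hasDerivAt_first_variation (hG : MetricBounds G s lam C) {c c' c'' h : ℝ → E}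
    {Θ : ℝ → ℝ} {θ t : ℝ} {k : E} (hc : HasDerivAt c (c' (Θ t)) (Θ t))
    (hc' : HasDerivAt c' (c'' (Θ t)) (Θ t)) (hs : c (Θ t) ∈ s)
    (hgeo : ∀ w, G (c (Θ t)) (c'' (Θ t)) w + fderiv ℝ G (c (Θ t)) (c' (Θ t)) (c' (Θ t)) w
      - fderiv ℝ G (c (Θ t)) w (c' (Θ t)) (c' (Θ t)) / 2 = 0)
    (hΘ : HasDerivAt Θ θ t) (hh : HasDerivAt h k t) :
    HasDerivAt (fun u => 2 * G (c (Θ u)) (c' (Θ u)) (h u))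
      (θ * fderiv ℝ G (c (Θ t)) (h t) (c' (Θ t)) (c' (Θ t)) + 2 * G (c (Θ t)) (c' (Θ t)) k) t := by
  have d1 : HasDerivAt (fun u => c (Θ u)) (θ • c' (Θ t)) t := hc.scomp t hΘ
  have d2 : HasDerivAt (fun u => c' (Θ u)) (θ • c'' (Θ t)) t := hc'.scomp t hΘ
  have d3 : HasDerivAt (fun u => G (c (Θ u))) (fderiv ℝ G (c (Θ t)) (θ • c' (Θ t))) t :=
    (hG.differentiableAt _ hs).hasFDerivAt.comp_hasDerivAt t d1
  have d4 := ((d3.clm_apply d2).clm_apply hh).const_mul 2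
  refine d4.congr_deriv ?_
  rw [(fderiv ℝ G (c (Θ t))).map_smul, (G (c (Θ t))).map_smul]
  simp only [add_apply, smul_apply, smul_eq_mul]
  -- The geodesic equation tested against `h t` eliminates the acceleration.
  linear_combination (2 * θ) * hgeo (h t)

/-- This plays the role of a Poincaré inequality for the deviation from the geodesic. -/
theorem norm_le_integral_norm {h k : ℝ → E} [CompleteSpace E] (h0 : h 0 = 0)
    (hcont : ContinuousOn h (Icc 0 1)) (hd : ∀ t ∈ Ioo (0 : ℝ) 1, HasDerivAt h (k t) t)
    (hk : ContinuousOn k (Icc 0 1)) {t : ℝ} (ht : t ∈ Icc (0 : ℝ) 1) :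
    ‖h t‖ ≤ ∫ u in (0 : ℝ)..1, ‖k u‖ := by
  have hi : IntervalIntegrable k MeasureTheory.volume 0 t :=
    (hk.mono (Icc_subset_Icc_right ht.2)).intervalIntegrable_of_Icc ht.1
  have h1 := intervalIntegral.integral_eq_sub_of_hasDerivAt_of_le ht.1
    (hcont.mono (Icc_subset_Icc_right ht.2))
    (fun u hu => hd u ⟨hu.1, hu.2.trans_le ht.2⟩) hi
  rw [h0, sub_zero] at h1
  rw [← h1]
  refine (intervalIntegral.norm_integral_le_integral_norm ht.1).trans ?_
  refine intervalIntegral.integral_mono_interval le_rfl ht.1 ht.2 ?_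
    (hk.norm.intervalIntegrable_of_Icc zero_le_one)
  exact Eventually.of_forall fun u => norm_nonneg _

/-- Write `σ = c ∘ Θ + h`, with `k` the derivative of `h`. The first order terms of the integrand
form the derivative of `2 G(c', h)`, which vanishes at both ends. With `m = ∫ ‖k‖` bounding `‖h‖`,
the second order terms contribute at least `(lam - 2 * K * τ ^ 2) * (m ^ 2 / (2 * τ))`, where `K` is
the constant of `hτ'`; this is nonnegative for short `τ`. -/
theorem energy_ge [CompleteSpace E] (hG : MetricBounds G s lam C) {τ s0 : ℝ} (hτ : 0 < τ)
    (hτ' : 2 * (2 * C ^ 2 / lam ^ 2 + C / lam) * τ ^ 2 ≤ lam) {c c' c'' : ℝ → E}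
    (hc : ∀ u ∈ Icc s0 (s0 + τ), HasDerivAt c (c' u) u)
    (hc' : ∀ u ∈ Icc s0 (s0 + τ), HasDerivAt c' (c'' u) u)
    (hcs : ∀ u ∈ Icc s0 (s0 + τ), c u ∈ s)
    (hunit : ∀ u ∈ Icc s0 (s0 + τ), G (c u) (c' u) (c' u) = 1)
    (hgeo : ∀ u ∈ Icc s0 (s0 + τ), ∀ w, G (c u) (c'' u) w + fderiv ℝ G (c u) (c' u) (c' u) w
      - fderiv ℝ G (c u) w (c' u) (c' u) / 2 = 0)
    {σ σ' : ℝ → E} (hσ : ContinuousOn σ (Icc 0 1)) (hσ' : ContinuousOn σ' (Icc 0 1))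
    (hd : ∀ t ∈ Ioo (0 : ℝ) 1, HasDerivAt σ (σ' t) t) (hσs : ∀ t ∈ Icc (0 : ℝ) 1, σ t ∈ s)
    (h0 : σ 0 = c s0) (h1 : σ 1 = c (s0 + τ))
    {Θ θ : ℝ → ℝ} (hΘ : ContinuousOn Θ (Icc 0 1)) (hθ : ContinuousOn θ (Icc 0 1))
    (hΘd : ∀ t ∈ Ioo (0 : ℝ) 1, HasDerivAt Θ (θ t) t) (hθpos : ∀ t ∈ Icc (0 : ℝ) 1, 0 < θ t)
    (hΘ0 : Θ 0 = s0) (hΘ1 : Θ 1 = s0 + τ) (hΘm : ∀ t ∈ Icc (0 : ℝ) 1, Θ t ∈ Icc s0 (s0 + τ)) :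
    τ ≤ ∫ t in (0 : ℝ)..1, G (σ t) (σ' t) (σ' t) / θ t := by
  have hl := hG.lam_pos
  have hCn := hG.nonneg
  obtain ⟨h, hh⟩ : ∃ h : ℝ → E, h = fun t => σ t - c (Θ t) := ⟨_, rfl⟩
  obtain ⟨k, hk⟩ : ∃ k : ℝ → E, k = fun t => σ' t - θ t • c' (Θ t) := ⟨_, rfl⟩
  obtain ⟨B, hB⟩ : ∃ B : ℝ → ℝ, B = fun t => 2 * G (c (Θ t)) (c' (Θ t)) (h t) := ⟨_, rfl⟩
  have hcc : ContinuousOn (fun t => c (Θ t)) (Icc 0 1) :=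
    ContinuousOn.comp (fun u hu => (hc u hu).continuousAt.continuousWithinAt) hΘ hΘm
  have hcc' : ContinuousOn (fun t => c' (Θ t)) (Icc 0 1) :=
    ContinuousOn.comp (fun u hu => (hc' u hu).continuousAt.continuousWithinAt) hΘ hΘm
  have hGc : ContinuousOn (fun t => G (c (Θ t))) (Icc 0 1) :=
    hG.continuousOn.comp hcc fun t ht => hcs _ (hΘm t ht)
  have hGσ : ContinuousOn (fun t => G (σ t)) (Icc 0 1) := hG.continuousOn.comp hσ hσs
  have hhc : ContinuousOn h (Icc 0 1) := hh ▸ hσ.sub hcc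
  have hkc : ContinuousOn k (Icc 0 1) := hk ▸ hσ'.sub (hθ.smul hcc')
  have hBc : ContinuousOn B (Icc 0 1) :=
    hB ▸ continuousOn_const.mul ((hGc.clm_apply hcc').clm_apply hhc)
  have hhd : ∀ t ∈ Ioo (0 : ℝ) 1, HasDerivAt h (k t) t := by
    intro t ht
    rw [hh, hk]
    exact (hd t ht).sub ((hc _ (hΘm t (Ioo_subset_Icc_self ht))).scomp t (hΘd t ht))
  have hh0 : h 0 = 0 := by simp [hh, h0, hΘ0]
  have hh1 : h 1 = 0 := by simp [hh, h1, hΘ1]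
  obtain ⟨m, hm⟩ : ∃ m : ℝ, m = ∫ u in (0 : ℝ)..1, ‖k u‖ := ⟨_, rfl⟩
  have hhm : ∀ t ∈ Icc (0 : ℝ) 1, ‖h t‖ ≤ m := fun t ht =>
    hm ▸ norm_le_integral_norm hh0 hhc hhd hkc ht
  obtain ⟨K, hK⟩ : ∃ K : ℝ, K = 2 * C ^ 2 / lam ^ 2 + C / lam := ⟨_, rfl⟩
  have hK0 : 0 ≤ K := by rw [hK]; positivity
  obtain ⟨F, hF⟩ : ∃ F : ℝ → ℝ, F = fun t => G (σ t) (σ' t) (σ' t) / θ t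
      - lam * (m / τ) * ‖k t‖ + (lam / 2 * (m / τ) ^ 2 + K * m ^ 2 - 1) * θ t := ⟨_, rfl⟩
  have c1 : ContinuousOn (fun t => G (σ t) (σ' t) (σ' t) / θ t) (Icc 0 1) :=
    ((hGσ.clm_apply hσ').clm_apply hσ').div hθ fun t ht => (hθpos t ht).ne'
  have hFc : ContinuousOn F (Icc 0 1) := by
    rw [hF]
    exact (c1.sub (continuousOn_const.mul hkc.norm)).add (continuousOn_const.mul hθ)
  have hFB : B 1 - B 0 ≤ ∫ t in (0 : ℝ)..1, F t := by
    refine intervalIntegral.sub_le_integral_of_hasDeriv_right_of_le zero_le_one hBc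
      (g' := fun t => θ t * fderiv ℝ G (c (Θ t)) (h t) (c' (Θ t)) (c' (Θ t))
        + 2 * G (c (Θ t)) (c' (Θ t)) (k t)) ?_ ?_ ?_
    · intro t ht
      have hm' := hΘm t (Ioo_subset_Icc_self ht)
      rw [hB]
      exact (hG.hasDerivAt_first_variation (hc _ hm') (hc' _ hm') (hcs _ hm') (hgeo _ hm')
        (hΘd t ht) (hhd t ht)).hasDerivWithinAt
    · exact hFc.integrableOn_Icc
    · intro t ht
      have ht' := Ioo_subset_Icc_self ht
      have hm' := hΘm t ht'
      have hp := hθpos t ht'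
      -- The slope `a = m / τ` maximizes `lam * a * m - lam / 2 * a ^ 2 * τ`, which is what
      -- integration leaves of the coercive part.
      have e := hG.energy_density_ge (z := σ t) (q := σ' t) (a := m / τ) (hcs _ hm') (hσs t ht')
        (hunit _ hm') hp.le
      have e2 : σ t - c (Θ t) = h t := by rw [hh]
      have e3 : σ' t - θ t • c' (Θ t) = k t := by rw [hk]
      rw [e2, e3, ← hK] at e
      have e4 : K * θ t ^ 2 * ‖h t‖ ^ 2 ≤ K * θ t ^ 2 * m ^ 2 := by
        have := hhm t ht'
        gcongr
      have e5 := e.trans' (sub_le_sub_left e4 _)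
      rw [hF]
      have e6 := (div_le_div_iff_of_pos_right hp).2 e5
      have e7 : (θ t ^ 2 * (1 + fderiv ℝ G (c (Θ t)) (h t) (c' (Θ t)) (c' (Θ t)))
          + 2 * θ t * G (c (Θ t)) (c' (Θ t)) (k t) + lam * (m / τ) * θ t * ‖k t‖
          - lam / 2 * (m / τ) ^ 2 * θ t ^ 2 - K * θ t ^ 2 * m ^ 2) / θ t =
          θ t * (1 + fderiv ℝ G (c (Θ t)) (h t) (c' (Θ t)) (c' (Θ t)))
          + 2 * G (c (Θ t)) (c' (Θ t)) (k t) + lam * (m / τ) * ‖k t‖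
          - lam / 2 * (m / τ) ^ 2 * θ t - K * θ t * m ^ 2 := by
        field_simp
      rw [e7] at e6
      simp only
      linarith
  have hB0 : B 0 = 0 := by simp [hB, hh0]
  have hB1 : B 1 = 0 := by simp [hB, hh1]
  have hθi : ∫ t in (0 : ℝ)..1, θ t = τ := by
    rw [intervalIntegral.integral_eq_sub_of_hasDerivAt_of_le zero_le_one hΘ hΘd
      (hθ.intervalIntegrable_of_Icc zero_le_one), hΘ0, hΘ1]
    ring
  have i1 := c1.intervalIntegrable_of_Icc (μ := MeasureTheory.volume) zero_le_one
  have i2 := (hkc.norm.intervalIntegrable_of_Icc (μ := MeasureTheory.volume) zero_le_one).const_mul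
    (lam * (m / τ))
  have i3 := (hθ.intervalIntegrable_of_Icc (μ := MeasureTheory.volume) zero_le_one).const_mul
    (lam / 2 * (m / τ) ^ 2 + K * m ^ 2 - 1)
  rw [hB0, hB1, hF, intervalIntegral.integral_add (i1.sub i2) i3, intervalIntegral.integral_sub i1 i2,
    intervalIntegral.integral_const_mul, intervalIntegral.integral_const_mul, hθi, ← hm] at hFB
  have e8 : lam * (m / τ) * m - (lam / 2 * (m / τ) ^ 2 + K * m ^ 2 - 1) * τ =
      (lam - 2 * K * τ ^ 2) * (m ^ 2 / (2 * τ)) + τ := by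
    field_simp
    ring
  have e9 : 0 ≤ (lam - 2 * K * τ ^ 2) * (m ^ 2 / (2 * τ)) := by
    rw [hK]
    have : 0 ≤ lam - 2 * (2 * C ^ 2 / lam ^ 2 + C / lam) * τ ^ 2 := by linarith
    positivity
  linarith

/-- Short geodesics minimize length among the curves contained in the domain of control. -/
theorem length_ge [CompleteSpace E] (hG : MetricBounds G s lam C) {τ s0 : ℝ} (hτ : 0 < τ)
    (hτ' : 2 * (2 * C ^ 2 / lam ^ 2 + C / lam) * τ ^ 2 ≤ lam) {c c' c'' : ℝ → E}
    (hc : ∀ u ∈ Icc s0 (s0 + τ), HasDerivAt c (c' u) u)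
    (hc' : ∀ u ∈ Icc s0 (s0 + τ), HasDerivAt c' (c'' u) u)
    (hcs : ∀ u ∈ Icc s0 (s0 + τ), c u ∈ s)
    (hunit : ∀ u ∈ Icc s0 (s0 + τ), G (c u) (c' u) (c' u) = 1)
    (hgeo : ∀ u ∈ Icc s0 (s0 + τ), ∀ w, G (c u) (c'' u) w + fderiv ℝ G (c u) (c' u) (c' u) w
      - fderiv ℝ G (c u) w (c' u) (c' u) / 2 = 0)
    {σ σ' : ℝ → E} (hσ : ContinuousOn σ (Icc 0 1)) (hσ' : ContinuousOn σ' (Icc 0 1))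
    (hd : ∀ t ∈ Ioo (0 : ℝ) 1, HasDerivAt σ (σ' t) t) (hσs : ∀ t ∈ Icc (0 : ℝ) 1, σ t ∈ s)
    (h0 : σ 0 = c s0) (h1 : σ 1 = c (s0 + τ)) :
    τ ≤ ∫ t in (0 : ℝ)..1, √(G (σ t) (σ' t) (σ' t)) := by
  obtain ⟨w, hw⟩ : ∃ w : ℝ → ℝ, w = fun t => √(G (σ t) (σ' t) (σ' t)) := ⟨_, rfl⟩
  have hGσ : ContinuousOn (fun t => G (σ t)) (Icc 0 1) := hG.continuousOn.comp hσ hσs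
  have hwc : ContinuousOn w (Icc 0 1) := by
    rw [hw]; exact ((hGσ.clm_apply hσ').clm_apply hσ').sqrt
  have hw0 : ∀ t, 0 ≤ w t := fun t => by rw [hw]; exact Real.sqrt_nonneg _
  have hwsq : ∀ t ∈ Icc (0 : ℝ) 1, G (σ t) (σ' t) (σ' t) = w t ^ 2 := by
    intro t ht
    rw [hw]
    refine (Real.sq_sqrt ?_).symm
    exact (mul_nonneg hG.lam_pos.le (sq_nonneg _)).trans (hG.coercive _ (hσs t ht) _)
  have hwi := hwc.intervalIntegrable_of_Icc (μ := MeasureTheory.volume) zero_le_one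
  rw [← hw]
  obtain ⟨l, hl⟩ : ∃ l : ℝ, l = ∫ t in (0 : ℝ)..1, w t := ⟨_, rfl⟩
  have hl0 : 0 ≤ l := hl ▸ intervalIntegral.integral_nonneg zero_le_one fun t _ => hw0 t
  rw [← hl]
  have key : ∀ ε > 0, τ ^ 2 ≤ l * (l + ε) := by
    intro ε hε
    -- `Θ` advances nearly in proportion to the arc length of `σ`; the `ε` keeps its speed `θ`
    -- positive where `σ` stops. The weighted energy is then at most `l * (l + ε) / τ`.
    obtain ⟨r, hr⟩ : ∃ r : ℝ, r = τ / (l + ε) := ⟨_, rfl⟩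
    have hr0 : 0 < r := by rw [hr]; positivity
    obtain ⟨θ, hθ⟩ : ∃ θ : ℝ → ℝ, θ = fun t => r * (w t + ε) := ⟨_, rfl⟩
    have hθc : ContinuousOn θ (Icc 0 1) := by
      rw [hθ]; exact continuousOn_const.mul (hwc.add continuousOn_const)
    have hθpos : ∀ t, 0 < θ t := fun t => by
      rw [hθ]; have := hw0 t; positivity
    have hθi := hθc.intervalIntegrable_of_Icc (μ := MeasureTheory.volume) zero_le_one
    have hθint : ∫ t in (0 : ℝ)..1, θ t = τ := by
      rw [hθ, intervalIntegral.integral_const_mul, intervalIntegral.integral_add hwi (by simp),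
        ← hl, hr]
      simp only [intervalIntegral.integral_const, sub_zero, smul_eq_mul, one_mul]
      field_simp
    have e := hG.energy_ge hτ hτ' hc hc' hcs hunit hgeo hσ hσ' hd hσs h0 h1
      (Θ := fun t => s0 + ∫ u in (0 : ℝ)..t, θ u) (θ := θ) ?_ hθc ?_ (fun t _ => hθpos t)
      (by simp) (by simp [hθint]) ?_
    · have e2 : ∫ t in (0 : ℝ)..1, G (σ t) (σ' t) (σ' t) / θ t ≤ ∫ t in (0 : ℝ)..1, r⁻¹ * w t := by
        refine intervalIntegral.integral_mono_on zero_le_one ?_ (hwi.const_mul _) ?_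
        · exact ContinuousOn.intervalIntegrable_of_Icc zero_le_one
            (((hGσ.clm_apply hσ').clm_apply hσ').div hθc fun t _ => (hθpos t).ne')
        · intro t ht
          rw [hwsq t ht, div_le_iff₀ (hθpos t), hθ]
          have := hw0 t
          have e3 : r⁻¹ * w t * (r * (w t + ε)) = w t * (w t + ε) := by field_simp
          simp only [e3]
          nlinarith
      rw [intervalIntegral.integral_const_mul, ← hl, hr] at e2
      have e4 := e.trans e2
      rw [inv_div, div_mul_eq_mul_div, le_div_iff₀ hτ] at e4
      linarith
    · refine continuousOn_const.add ?_
      have := intervalIntegral.continuousOn_primitive_interval (a := 0) (b := 1) (f := θ)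
        (μ := MeasureTheory.volume) (by
          rw [uIcc_of_le zero_le_one]; exact hθc.integrableOn_Icc)
      rwa [uIcc_of_le zero_le_one] at this
    · intro t ht
      refine HasDerivAt.const_add s0 ?_
      refine intervalIntegral.integral_hasDerivAt_right
        (hθi.mono_set ?_) ?_ (hθc.continuousAt (Icc_mem_nhds ht.1 ht.2))
      · rw [uIcc_of_le ht.1.le, uIcc_of_le zero_le_one]
        exact Icc_subset_Icc_right ht.2.le
      · exact (hθc.mono Ioo_subset_Icc_self).stronglyMeasurableAtFilter isOpen_Ioo t ht
    · intro t ht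
      constructor
      · have := intervalIntegral.integral_nonneg (f := θ) (μ := MeasureTheory.volume) ht.1
          fun u _ => (hθpos u).le
        linarith
      · have := intervalIntegral.integral_mono_interval (f := θ) (μ := MeasureTheory.volume)
          le_rfl ht.1 ht.2 (Eventually.of_forall fun u => (hθpos u).le) hθi
        rw [hθint] at this
        linarith
  have h2 : τ ^ 2 ≤ l ^ 2 := by
    refine le_of_forall_pos_le_add fun ε hε => ?_
    have := key (ε / (l + 1)) (by positivity)
    have h3 : l * (ε / (l + 1)) ≤ ε := by
      rw [mul_div_assoc', div_le_iff₀ (by positivity)]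
      nlinarith
    nlinarith
  exact (pow_le_pow_iff_left₀ hτ.le hl0 two_ne_zero).1 h2

end MetricBounds

end EnergyComparison

/-! ### The geodesic equation in a chart and constancy of speed -/

section ChartGeodesics

variable {E : Type*} [NormedAddCommGroup E] [NormedSpace ℝ E] [FiniteDimensional ℝ E]
  {M : Type*} [TopologicalSpace M] [ChartedSpace E M] [IsManifold 𝓘(ℝ, E) ∞ M]
  [RiemannianBundle (fun x : M => TangentSpace 𝓘(ℝ, E) x)]
  [IsContMDiffRiemannianBundle 𝓘(ℝ, E) ∞ E (fun x : M => TangentSpace 𝓘(ℝ, E) x)]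

theorem differentiableAt_chartMetric (a : M) {y : E}
    (hy : y ∈ (extChartAt 𝓘(ℝ, E) a).target) :
    DifferentiableAt ℝ (chartMetric (E := E) a) y :=
  ((contDiffOn_chartMetric a).differentiableOn (by simp)).differentiableAt
    ((isOpen_extChartAt_target a).mem_nhds hy)

theorem fderiv_coordMetric (a : M) {y : E} (hy : y ∈ (extChartAt 𝓘(ℝ, E) a).target) (u v w : E) :
    fderiv ℝ (fun z => coordMetric E a z v w) y u = fderiv ℝ (chartMetric (E := E) a) y u v w := by
  have h := (differentiableAt_chartMetric a hy).hasFDerivAt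
  have h1 := (h.clm_apply (hasFDerivAt_const v y)).clm_apply (hasFDerivAt_const w y)
  have h2 : HasFDerivAt (fun z => coordMetric E a z v w) _ y := h1
  rw [h2.fderiv]
  simp

theorem christoffelFirst_self (a : M) {y : E} (hy : y ∈ (extChartAt 𝓘(ℝ, E) a).target) (v w : E) :
    christoffelFirst E a y v v w = fderiv ℝ (chartMetric (E := E) a) y v v w
      - fderiv ℝ (chartMetric (E := E) a) y w v v / 2 := by
  rw [christoffelFirst, fderiv_coordMetric a hy, fderiv_coordMetric a hy]
  ring

/-- The constants controlling the metric on a compact convex subset of a chart domain. -/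
theorem exists_metricBounds_chartMetric (a : M) {s : Set E}
    (hs : s ⊆ (extChartAt 𝓘(ℝ, E) a).target) (hc : IsCompact s) (hconv : Convex ℝ s) :
    ∃ lam C : ℝ, MetricBounds (chartMetric (E := E) a) s lam C :=
  exists_metricBounds (isOpen_extChartAt_target a) (contDiffOn_chartMetric a)
    (fun y _ v w => coordMetric_symm a y v w)
    (fun _ hy _ hv => coordMetric_self_pos a hy hv) hs hc hconv

omit [FiniteDimensional ℝ E]
  [IsContMDiffRiemannianBundle 𝓘(ℝ, E) ∞ E (fun x : M => TangentSpace 𝓘(ℝ, E) x)] in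
theorem IsGeodesic.hasDerivAt {γ : ℝ → M} (hγ : IsGeodesic E γ) (a : M) {t : ℝ}
    (ht : γ t ∈ (extChartAt 𝓘(ℝ, E) a).source) :
    HasDerivAt (fun u => extChartAt 𝓘(ℝ, E) a (γ u))
      (deriv (fun u => extChartAt 𝓘(ℝ, E) a (γ u)) t) t ∧
    HasDerivAt (deriv (fun u => extChartAt 𝓘(ℝ, E) a (γ u)))
      (deriv (deriv (fun u => extChartAt 𝓘(ℝ, E) a (γ u))) t) t := by
  have h : ContDiffAt ℝ 2 (fun u => extChartAt 𝓘(ℝ, E) a (γ u)) t :=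
    contDiffAt_extChartAt_comp a (n := 2) hγ.1.contMDiffAt ht
  refine ⟨(h.differentiableAt (by simp)).hasDerivAt, DifferentiableAt.hasDerivAt ?_⟩
  have h1 : ContDiffAt ℝ 1 (deriv (fun u => extChartAt 𝓘(ℝ, E) a (γ u))) t :=
    h.derivWithin (by norm_num)
  exact h1.differentiableAt (by simp)

theorem IsGeodesic.equation {γ : ℝ → M} (hγ : IsGeodesic E γ) (a : M) {t : ℝ}
    (ht : γ t ∈ (extChartAt 𝓘(ℝ, E) a).source) {c : ℝ → E}
    (hc : c = fun u => extChartAt 𝓘(ℝ, E) a (γ u)) (w : E) :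
    chartMetric a (c t) (deriv (deriv c) t) w
      + fderiv ℝ (chartMetric (E := E) a) (c t) (deriv c t) (deriv c t) w
      - fderiv ℝ (chartMetric (E := E) a) (c t) w (deriv c t) (deriv c t) / 2 = 0 := by
  have h := hγ.2 a t ht w
  have hct : extChartAt 𝓘(ℝ, E) a (γ t) = c t := by rw [hc]
  simp only [← hc, hct] at h
  have ht' : c t ∈ (extChartAt 𝓘(ℝ, E) a).target := by
    rw [hc]; exact (extChartAt 𝓘(ℝ, E) a).map_source ht
  rw [christoffelFirst_self a ht'] at h
  rw [chartMetric_apply, add_sub_assoc]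
  exact h

omit [FiniteDimensional ℝ E]
  [IsContMDiffRiemannianBundle 𝓘(ℝ, E) ∞ E (fun x : M => TangentSpace 𝓘(ℝ, E) x)] in
theorem IsGeodesic.norm_sq {γ : ℝ → M} (hγ : IsGeodesic E γ) (a : M) {t : ℝ}
    (ht : γ t ∈ (extChartAt 𝓘(ℝ, E) a).source) :
    ‖mfderiv 𝓘(ℝ, ℝ) 𝓘(ℝ, E) γ t (1 : ℝ)‖ ^ 2 =
      coordMetric E a (extChartAt 𝓘(ℝ, E) a (γ t))
        (deriv (fun u => extChartAt 𝓘(ℝ, E) a (γ u)) t)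
        (deriv (fun u => extChartAt 𝓘(ℝ, E) a (γ u)) t) :=
  norm_mfderiv_sq a (hγ.1.mdifferentiable (by simp) t) ht (hγ.hasDerivAt a ht).1

/-- Geodesics have constant speed. -/
theorem IsGeodesic.exists_speed {γ : ℝ → M} (hγ : IsGeodesic E γ) :
    ∃ v : ℝ, 0 ≤ v ∧ ∀ t, ‖mfderiv 𝓘(ℝ, ℝ) 𝓘(ℝ, E) γ t (1 : ℝ)‖ = v := by
  have key : ∀ t, HasDerivAt (fun u => ‖mfderiv 𝓘(ℝ, ℝ) 𝓘(ℝ, E) γ u (1 : ℝ)‖ ^ 2) 0 t := by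
    intro t
    have ht : γ t ∈ (extChartAt 𝓘(ℝ, E) (γ t)).source := mem_extChartAt_source _
    obtain ⟨c, hc⟩ : ∃ c : ℝ → E, c = fun u => extChartAt 𝓘(ℝ, E) (γ t) (γ u) := ⟨_, rfl⟩
    have hev : (fun u => ‖mfderiv 𝓘(ℝ, ℝ) 𝓘(ℝ, E) γ u (1 : ℝ)‖ ^ 2) =ᶠ[𝓝 t]
        fun u => chartMetric (γ t) (c u) (deriv c u) (deriv c u) := by
      filter_upwards [hγ.1.continuous.continuousAt (extChartAt_source_mem_nhds (I := 𝓘(ℝ, E)) (γ t))]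
        with u hu
      rw [hγ.norm_sq (γ t) hu, hc, chartMetric_apply]
    refine HasDerivAt.congr_of_eventuallyEq ?_ hev
    have ht' : c t ∈ (extChartAt 𝓘(ℝ, E) (γ t)).target := by
      rw [hc]; exact (extChartAt 𝓘(ℝ, E) (γ t)).map_source ht
    obtain ⟨d1, d2⟩ := hγ.hasDerivAt (γ t) ht
    rw [← hc] at d1 d2
    have d3 := (differentiableAt_chartMetric (γ t) ht').hasFDerivAt.comp_hasDerivAt t d1
    have d4 := (d3.clm_apply d2).clm_apply d2
    refine d4.congr_deriv ?_
    -- Tested against the velocity, the geodesic equation says that half the derivative of the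
    -- squared speed vanishes.
    have e := hγ.equation (γ t) ht hc (deriv c t)
    simp only [add_apply, Function.comp_apply]
    have e2 : chartMetric (γ t) (c t) (deriv c t) (deriv (deriv c) t) =
      chartMetric (γ t) (c t) (deriv (deriv c) t) (deriv c t) := coordMetric_symm _ _ _ _
    rw [e2]
    linarith
  have hconst := is_const_of_deriv_eq_zero (fun t => (key t).differentiableAt)
    (fun t => (key t).deriv)
  refine ⟨‖mfderiv 𝓘(ℝ, ℝ) 𝓘(ℝ, E) γ 0 (1 : ℝ)‖, norm_nonneg _, fun t => ?_⟩
  exact (pow_left_inj₀ (norm_nonneg _) (norm_nonneg _) two_ne_zero).1 (hconst t 0)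

end ChartGeodesics

/-! ### Local minimization, uniformly over a compact manifold -/

section Minimizing

variable {E : Type*} [NormedAddCommGroup E] [NormedSpace ℝ E] [FiniteDimensional ℝ E]
  {M : Type*} [MetricSpace M] [ChartedSpace E M] [IsManifold 𝓘(ℝ, E) ∞ M]
  [RiemannianBundle (fun x : M => TangentSpace 𝓘(ℝ, E) x)]
  [IsContMDiffRiemannianBundle 𝓘(ℝ, E) ∞ E (fun x : M => TangentSpace 𝓘(ℝ, E) x)]
  [IsRiemannianManifold 𝓘(ℝ, E) M]

omit [FiniteDimensional ℝ E] [IsManifold 𝓘(ℝ, E) ∞ M]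
  [IsContMDiffRiemannianBundle 𝓘(ℝ, E) ∞ E (fun x : M => TangentSpace 𝓘(ℝ, E) x)] in
theorem edist_le_pathELength {σ : ℝ → M} {a b : ℝ} (hab : a ≤ b)
    (hσ : ContMDiffOn 𝓘(ℝ, ℝ) 𝓘(ℝ, E) 1 σ (Icc a b)) :
    edist (σ a) (σ b) ≤ Manifold.pathELength 𝓘(ℝ, E) σ a b := by
  rw [IsRiemannianManifold.out (I := 𝓘(ℝ, E)) (σ a) (σ b)]
  exact Manifold.riemannianEDist_le_pathELength hσ rfl rfl hab

omit [FiniteDimensional ℝ E] [IsManifold 𝓘(ℝ, E) ∞ M]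
  [IsContMDiffRiemannianBundle 𝓘(ℝ, E) ∞ E (fun x : M => TangentSpace 𝓘(ℝ, E) x)] in
theorem dist_le_of_norm_mfderiv_eq {γ : ℝ → M} (hγ : ContMDiff 𝓘(ℝ, ℝ) 𝓘(ℝ, E) 1 γ) {v : ℝ}
    (hv : ∀ t, ‖mfderiv 𝓘(ℝ, ℝ) 𝓘(ℝ, E) γ t (1 : ℝ)‖ = v) (s t : ℝ) :
    dist (γ s) (γ t) ≤ v * |s - t| := by
  wlog hst : s ≤ t generalizing s t
  · rw [dist_comm, abs_sub_comm]; exact this t s (le_of_not_ge hst)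
  have hv0 : 0 ≤ v := hv 0 ▸ norm_nonneg _
  have h := edist_le_pathELength hst (hγ.contMDiffOn (s := Icc s t))
  rw [Manifold.pathELength_eq_lintegral_mfderiv_Icc] at h
  have h2 : ∫⁻ u in Icc s t, ‖mfderiv 𝓘(ℝ, ℝ) 𝓘(ℝ, E) γ u (1 : ℝ)‖ₑ =
      ENNReal.ofReal (v * |s - t|) := by
    have h3 : ∀ u, ‖mfderiv 𝓘(ℝ, ℝ) 𝓘(ℝ, E) γ u (1 : ℝ)‖ₑ = ENNReal.ofReal v := fun u => by
      rw [← ofReal_norm, hv u]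
    simp only [h3]
    rw [MeasureTheory.setLIntegral_const, Real.volume_Icc, ← ENNReal.ofReal_mul hv0,
      abs_sub_comm, abs_of_nonneg (sub_nonneg.2 hst)]
  have h4 := h.trans h2.le
  rwa [edist_dist, ENNReal.ofReal_le_ofReal_iff (by positivity)] at h4

omit [FiniteDimensional ℝ E] [IsManifold 𝓘(ℝ, E) ∞ M]
  [IsContMDiffRiemannianBundle 𝓘(ℝ, E) ∞ E (fun x : M => TangentSpace 𝓘(ℝ, E) x)] in
theorem dist_le_of_isUnitSpeed {γ : ℝ → M} (hγ : IsGeodesic E γ) (hu : IsUnitSpeed E γ)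
    (s t : ℝ) : dist (γ s) (γ t) ≤ |s - t| := by
  simpa using dist_le_of_norm_mfderiv_eq (hγ.1.of_le (by norm_num)) hu s t

omit [IsRiemannianManifold 𝓘(ℝ, E) M] in
/-- The length of a curve inside a chart is the integral of its coordinate speed. -/
theorem pathELength_eq_ofReal_integral (a : M) {σ : ℝ → M}
    (hσ : ContMDiffOn 𝓘(ℝ, ℝ) 𝓘(ℝ, E) 1 σ (Icc 0 1))
    (hs : ∀ t ∈ Icc (0 : ℝ) 1, σ t ∈ (extChartAt 𝓘(ℝ, E) a).source) {σE σ' : ℝ → E}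
    (hσE : σE = fun u => extChartAt 𝓘(ℝ, E) a (σ u))
    (hσ' : σ' = derivWithin σE (Icc 0 1)) :
    ContinuousOn σE (Icc 0 1) ∧ ContinuousOn σ' (Icc 0 1) ∧
    (∀ t ∈ Ioo (0 : ℝ) 1, HasDerivAt σE (σ' t) t) ∧
    Manifold.pathELength 𝓘(ℝ, E) σ 0 1 =
      ENNReal.ofReal (∫ t in (0 : ℝ)..1, √(chartMetric a (σE t) (σ' t) (σ' t))) := by
  have hcd : ContDiffOn ℝ 1 σE (Icc 0 1) := fun t ht => by
    rw [hσE]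
    exact contDiffWithinAt_extChartAt_comp a (n := 1) (hσ t ht) (hs t ht)
  have hud : UniqueDiffOn ℝ (Icc (0 : ℝ) 1) := uniqueDiffOn_Icc zero_lt_one
  have hdw : ∀ t ∈ Icc (0 : ℝ) 1, HasDerivWithinAt σE (σ' t) (Icc 0 1) t := fun t ht => by
    rw [hσ']
    exact ((hcd.differentiableOn (by simp)) t ht).hasDerivWithinAt
  have hc' : ContinuousOn σ' (Icc 0 1) := by
    rw [hσ']; exact hcd.continuousOn_derivWithin hud (by simp)
  refine ⟨hcd.continuousOn, hc',
    fun t ht => (hdw t (Ioo_subset_Icc_self ht)).hasDerivAt (Icc_mem_nhds ht.1 ht.2), ?_⟩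
  have hG : ContinuousOn (fun t => chartMetric a (σE t)) (Icc 0 1) := by
    refine (contDiffOn_chartMetric a).continuousOn.comp hcd.continuousOn fun t ht => ?_
    rw [hσE]
    exact (extChartAt 𝓘(ℝ, E) a).map_source (hs t ht)
  have hw : ContinuousOn (fun t => √(chartMetric a (σE t) (σ' t) (σ' t))) (Icc 0 1) :=
    ((hG.clm_apply hc').clm_apply hc').sqrt
  rw [intervalIntegral.integral_of_le zero_le_one, ← MeasureTheory.integral_Icc_eq_integral_Ioc,
    MeasureTheory.ofReal_integral_eq_lintegral_ofReal hw.integrableOn_Icc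
      (Eventually.of_forall fun t => Real.sqrt_nonneg _),
    Manifold.pathELength_eq_lintegral_mfderivWithin_Icc]
  refine MeasureTheory.setLIntegral_congr_fun measurableSet_Icc fun t ht => ?_
  have h := norm_mfderivWithin_sq a ((hσ t ht).mdifferentiableWithinAt (by simp)) (hs t ht)
    (v := σ' t) (by have := hdw t ht; rwa [hσE] at this) (hud t ht)
  have h2 : ‖mfderivWithin 𝓘(ℝ, ℝ) 𝓘(ℝ, E) σ (Icc 0 1) t (1 : ℝ)‖ =
      √(chartMetric a (σE t) (σ' t) (σ' t)) := by
    rw [chartMetric_apply, hσE]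
    exact (Real.sqrt_sq (norm_nonneg _)).symm.trans (congrArg Real.sqrt h)
  change ‖mfderivWithin 𝓘(ℝ, ℝ) 𝓘(ℝ, E) σ (Icc 0 1) t (1 : ℝ)‖ₑ = _
  rw [← ofReal_norm, h2]

omit [IsRiemannianManifold 𝓘(ℝ, E) M] in
/-- Around every point, a uniform control of the metric on a metric ball. -/
theorem exists_ball_metricBounds (p : M) {a : M} (hp : p ∈ (extChartAt 𝓘(ℝ, E) a).source) :
    ∃ r > 0, ∃ (s : Set E) (lam C : ℝ), MetricBounds (chartMetric (E := E) a) s lam C ∧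
      IsCompact s ∧ s ⊆ (extChartAt 𝓘(ℝ, E) a).target ∧
      ∀ x ∈ Metric.ball p r, x ∈ (extChartAt 𝓘(ℝ, E) a).source ∧ extChartAt 𝓘(ℝ, E) a x ∈ s := by
  have := FiniteDimensional.proper_real E
  obtain ⟨ρ, hρ, hball⟩ := Metric.nhds_basis_closedBall.mem_iff.1
    ((isOpen_extChartAt_target (I := 𝓘(ℝ, E)) a).mem_nhds
      ((extChartAt 𝓘(ℝ, E) a).map_source hp))
  obtain ⟨lam, C, hG⟩ := exists_metricBounds_chartMetric a hball (isCompact_closedBall _ _)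
    (convex_closedBall _ _)
  have h1 : (extChartAt 𝓘(ℝ, E) a).source ∈ 𝓝 p := extChartAt_source_mem_nhds' hp
  have h2 := (continuousAt_extChartAt' hp).preimage_mem_nhds (Metric.closedBall_mem_nhds _ hρ)
  obtain ⟨r, hr, hr'⟩ := Metric.mem_nhds_iff.1 (inter_mem h1 h2)
  exact ⟨r, hr, _, lam, C, hG, isCompact_closedBall _ _, hball, hr'⟩

/-- Unit speed geodesics starting near `p` minimize distance on a uniform interval. -/
theorem exists_nhds_minimizing (p : M) : ∃ U ∈ 𝓝 p, ∃ r > 0, ∀ γ : ℝ → M, IsGeodesic E γ →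
    IsUnitSpeed E γ → ∀ s τ, γ s ∈ U → 0 ≤ τ → τ ≤ r → dist (γ s) (γ (s + τ)) = τ := by
  obtain ⟨r, hr, S, lam, C, hG, -, hS, hball⟩ :=
    exists_ball_metricBounds (E := E) p (mem_extChartAt_source (I := 𝓘(ℝ, E)) p)
  obtain ⟨K, hK⟩ : ∃ K : ℝ, K = 2 * C ^ 2 / lam ^ 2 + C / lam := ⟨_, rfl⟩
  have hl := hG.lam_pos
  have hC := hG.nonneg
  have hK0 : 0 ≤ K := by rw [hK]; positivity
  -- For `τ ≤ r'` the smallness condition of `MetricBounds.length_ge` holds; `K + 1` keeps the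
  -- denominator positive.
  obtain ⟨r', hr'⟩ : ∃ r' : ℝ, r' = √(lam / (2 * (K + 1))) := ⟨_, rfl⟩
  have hr'0 : 0 < r' := by rw [hr']; positivity
  refine ⟨Metric.ball p (r / 2), Metric.ball_mem_nhds _ (by positivity), min (r / 2) r',
    by positivity, fun γ hγ hu s τ hsU hτ0 hτ => ?_⟩
  have hle := dist_le_of_isUnitSpeed hγ hu
  refine le_antisymm ((hle _ _).trans_eq (by simp [abs_of_nonneg hτ0])) ?_
  by_contra! hlt
  have hτpos : 0 < τ := dist_nonneg.trans_lt hlt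
  have hballτ : ∀ x, dist (γ s) x ≤ τ → x ∈ Metric.ball p r := fun x hx => by
    rw [Metric.mem_ball] at hsU ⊢
    have := dist_triangle_left x p (γ s)
    have := hτ.trans (min_le_left _ _)
    linarith
  have hlt' : Manifold.riemannianEDist 𝓘(ℝ, E) (γ s) (γ (s + τ)) < ENNReal.ofReal τ := by
    rw [← IsRiemannianManifold.out (I := 𝓘(ℝ, E)) (γ s) (γ (s + τ)), edist_dist]
    exact (ENNReal.ofReal_lt_ofReal_iff hτpos).2 hlt
  obtain ⟨σ, h0, h1, hσ, hlen⟩ := Manifold.exists_lt_of_riemannianEDist_lt hlt'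
  -- A competitor of length below `τ ≤ r / 2`, starting within `r / 2` of `p`, cannot leave the
  -- controlled ball.
  have hσball : ∀ t ∈ Icc (0 : ℝ) 1, σ t ∈ Metric.ball p r := by
    intro t ht
    refine hballτ _ ?_
    have h2 := edist_le_pathELength ht.1 (hσ.mono (Icc_subset_Icc_right ht.2))
    have h3 := (h2.trans (Manifold.pathELength_mono le_rfl ht.2)).trans hlen.le
    rwa [h0, edist_dist, ENNReal.ofReal_le_ofReal_iff hτ0] at h3
  have hγball : ∀ u ∈ Icc s (s + τ), γ u ∈ Metric.ball p r := by
    intro u hu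
    refine hballτ _ ((hle _ _).trans ?_)
    rw [abs_sub_comm, abs_of_nonneg (by linarith [hu.1])]
    linarith [hu.2]
  obtain ⟨e1, e2, e3, e4⟩ := pathELength_eq_ofReal_integral p hσ
    (fun t ht => (hball _ (hσball t ht)).1) rfl rfl
  obtain ⟨c, hc⟩ : ∃ c : ℝ → E, c = fun u => extChartAt 𝓘(ℝ, E) p (γ u) := ⟨_, rfl⟩
  have hτ' : 2 * (2 * C ^ 2 / lam ^ 2 + C / lam) * τ ^ 2 ≤ lam := by
    rw [← hK]
    have h5 : τ ^ 2 ≤ lam / (2 * (K + 1)) := by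
      rw [← Real.sq_sqrt (by positivity : 0 ≤ lam / (2 * (K + 1))), ← hr']
      have := hτ.trans (min_le_right _ _)
      gcongr
    rw [le_div_iff₀ (by positivity)] at h5
    nlinarith [sq_nonneg τ]
  have h6 := hG.length_ge hτpos hτ' (s0 := s) (c := c) (c' := deriv c) (c'' := deriv (deriv c))
    (fun u hu => by
      have := (hγ.hasDerivAt p (hball _ (hγball u hu)).1).1
      rwa [← hc] at this)
    (fun u hu => by
      have := (hγ.hasDerivAt p (hball _ (hγball u hu)).1).2
      rwa [← hc] at this)
    (fun u hu => by rw [hc]; exact (hball _ (hγball u hu)).2)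
    (fun u hu' => by
      have := hγ.norm_sq p (hball _ (hγball u hu')).1
      rw [hu u] at this
      rw [hc, chartMetric_apply, ← this, one_pow])
    (fun u hu w => hγ.equation p (hball _ (hγball u hu)).1 hc w)
    e1 e2 e3 (fun t ht => (hball _ (hσball t ht)).2) (by rw [h0, hc]) (by rw [h1, hc])
  rw [e4] at hlen
  exact absurd ((ENNReal.ofReal_lt_ofReal_iff hτpos).1 hlen) (not_lt.2 h6)

/-- On a compact Riemannian manifold, unit speed geodesics minimize distance on intervals of a
uniform length. -/
theorem exists_uniform_minimizing [CompactSpace M] : ∃ r > 0, ∀ γ : ℝ → M, IsGeodesic E γ →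
    IsUnitSpeed E γ → ∀ s t, |s - t| ≤ r → dist (γ s) (γ t) = |s - t| := by
  have key : ∃ r > 0, ∀ γ : ℝ → M, IsGeodesic E γ → IsUnitSpeed E γ →
      ∀ s τ, γ s ∈ (univ : Set M) → 0 ≤ τ → τ ≤ r → dist (γ s) (γ (s + τ)) = τ := by
    refine isCompact_univ.induction_on (p := fun U : Set M => ∃ r > 0, ∀ γ : ℝ → M,
      IsGeodesic E γ → IsUnitSpeed E γ →
      ∀ s τ, γ s ∈ U → 0 ≤ τ → τ ≤ r → dist (γ s) (γ (s + τ)) = τ) ?_ ?_ ?_ ?_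
    · exact ⟨1, one_pos, fun γ _ _ s τ h => absurd h (notMem_empty _)⟩
    · rintro U V hUV ⟨r, hr, h⟩
      exact ⟨r, hr, fun γ h1 h2 s τ h3 => h γ h1 h2 s τ (hUV h3)⟩
    · rintro U V ⟨r, hr, h⟩ ⟨r', hr', h'⟩
      refine ⟨min r r', lt_min hr hr', fun γ h1 h2 s τ h3 h4 h5 => ?_⟩
      rcases h3 with h3 | h3
      · exact h γ h1 h2 s τ h3 h4 (h5.trans (min_le_left _ _))
      · exact h' γ h1 h2 s τ h3 h4 (h5.trans (min_le_right _ _))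
    · intro p _
      obtain ⟨U, hU, h⟩ := exists_nhds_minimizing (E := E) p
      exact ⟨U, mem_nhdsWithin_of_mem_nhds hU, h⟩
  obtain ⟨r, hr, h⟩ := key
  refine ⟨r, hr, fun γ h1 h2 s t hst => ?_⟩
  wlog hle : s ≤ t generalizing s t
  · rw [dist_comm, abs_sub_comm]
    exact this t s (by rwa [abs_sub_comm]) (le_of_not_ge hle)
  rw [abs_sub_comm, abs_of_nonneg (sub_nonneg.2 hle)] at hst ⊢
  have := h γ h1 h2 s (t - s) (mem_univ _) (sub_nonneg.2 hle) hst
  rwa [add_sub_cancel] at this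

end Minimizing

/-! ### A priori bounds for geodesics and limits of derivatives -/

section Acceleration

variable {E : Type*} [NormedAddCommGroup E] [NormedSpace ℝ E]

theorem abs_trilinear_le (T : E →L[ℝ] E →L[ℝ] E →L[ℝ] ℝ) {K : ℝ} (hT : ‖T‖ ≤ K) (u v w : E) :
    |T u v w| ≤ K * ‖u‖ * ‖v‖ * ‖w‖ :=
  MetricBounds.abs_le_of_norm_le _ ((T.le_opNorm u).trans (by gcongr)) v w

namespace MetricBounds

variable {G : E → E →L[ℝ] E →L[ℝ] ℝ} {s : Set E} {lam C : ℝ}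

theorem norm_le_div_of_mul_sq_le {lam B x : ℝ} (hl : 0 < lam) (hB : 0 ≤ B) (hx : 0 ≤ x)
    (h : lam * x ^ 2 ≤ B * x) : x ≤ B / lam := by
  rw [le_div_iff₀ hl]
  rcases hx.eq_or_lt with rfl | hx
  · simpa using hB
  · nlinarith

/-- Test the equation against `b`: coercivity gives `lam * ‖b‖ ^ 2` on one side, the other is linear
in `b`. -/
theorem norm_acceleration_le (hG : MetricBounds G s lam C) {y p b : E} {V : ℝ} (hy : y ∈ s)
    (hp : ‖p‖ ≤ V) (hgeo : ∀ w, G y b w + fderiv ℝ G y p p w - fderiv ℝ G y w p p / 2 = 0) :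
    ‖b‖ ≤ (3 / 2 * (C * V ^ 2)) / lam := by
  have hC := hG.nonneg
  have hV : 0 ≤ V := (norm_nonneg _).trans hp
  refine norm_le_div_of_mul_sq_le hG.lam_pos (by positivity) (norm_nonneg _) ?_
  have h1 := hG.coercive y hy b
  have h2 := (abs_le.1 (abs_trilinear_le _ (hG.fderiv_bound y hy) p p b)).1
  have h3 := (abs_le.1 (abs_trilinear_le _ (hG.fderiv_bound y hy) b p p)).2
  have h4 : C * ‖p‖ * ‖p‖ * ‖b‖ ≤ C * V * V * ‖b‖ := by gcongr
  have h5 : C * ‖b‖ * ‖p‖ * ‖p‖ ≤ C * ‖b‖ * V * V := by gcongr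
  have h6 := hgeo b
  linarith

theorem abs_trilinear_sub_le (hG : MetricBounds G s lam C) {y z p q x : E} {V : ℝ} (hy : y ∈ s)
    (hz : z ∈ s) (hp : ‖p‖ ≤ V) (hq : ‖q‖ ≤ V) :
    |fderiv ℝ G y p p x - fderiv ℝ G z q q x| ≤
      (C * ‖y - z‖ * V ^ 2 + 2 * C * V * ‖p - q‖) * ‖x‖ ∧
    |fderiv ℝ G y x p p - fderiv ℝ G z x q q| ≤
      (C * ‖y - z‖ * V ^ 2 + 2 * C * V * ‖p - q‖) * ‖x‖ := by
  have hC := hG.nonneg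
  have hV : 0 ≤ V := (norm_nonneg _).trans hp
  have hl := hG.fderiv_lip z hz y hy
  have hb := hG.fderiv_bound z hz
  have a1 := abs_trilinear_le _ hl p p x
  have a2 := abs_trilinear_le _ hb (p - q) p x
  have a3 := abs_trilinear_le _ hb q (p - q) x
  have b1 := abs_trilinear_le _ hl x p p
  have b2 := abs_trilinear_le _ hb x (p - q) p
  have b3 := abs_trilinear_le _ hb x q (p - q)
  simp only [map_sub, sub_apply] at a1 a2 a3 b1 b2 b3
  have m1 : C * ‖y - z‖ * ‖p‖ * ‖p‖ * ‖x‖ ≤ C * ‖y - z‖ * V * V * ‖x‖ := by gcongr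
  have m2 : C * ‖p - q‖ * ‖p‖ * ‖x‖ ≤ C * ‖p - q‖ * V * ‖x‖ := by gcongr
  have m3 : C * ‖q‖ * ‖p - q‖ * ‖x‖ ≤ C * V * ‖p - q‖ * ‖x‖ := by gcongr
  rw [abs_le] at a1 a2 a3 b1 b2 b3
  refine ⟨abs_le.2 ⟨?_, ?_⟩, abs_le.2 ⟨?_, ?_⟩⟩
  · linarith [a1.1, a2.1, a3.1]
  · linarith [a1.2, a2.2, a3.2]
  · linarith [b1.1, b2.1, b3.1]
  · linarith [b1.2, b2.2, b3.2]

/-- Test the difference of the two equations against `b - e`. The term with `A` comes from replacing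
`G z` by `G y` on `e`. -/
theorem norm_acceleration_sub_le (hG : MetricBounds G s lam C) {y z p q b e : E} {V A : ℝ}
    (hy : y ∈ s) (hz : z ∈ s) (hp : ‖p‖ ≤ V) (hq : ‖q‖ ≤ V) (he : ‖e‖ ≤ A)
    (hgeo : ∀ w, G y b w + fderiv ℝ G y p p w - fderiv ℝ G y w p p / 2 = 0)
    (hgeo' : ∀ w, G z e w + fderiv ℝ G z q q w - fderiv ℝ G z w q q / 2 = 0) :
    ‖b - e‖ ≤ (C * ‖y - z‖ * A + 3 / 2 * (C * ‖y - z‖ * V ^ 2 + 2 * C * V * ‖p - q‖)) / lam := by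
  have hC := hG.nonneg
  have hV : 0 ≤ V := (norm_nonneg _).trans hp
  have hA : 0 ≤ A := (norm_nonneg _).trans he
  refine norm_le_div_of_mul_sq_le hG.lam_pos (by positivity) (norm_nonneg _) ?_
  have h1 := hG.coercive y hy (b - e)
  have h2 := abs_le_of_norm_le _ (hG.lip z hz y hy) e (b - e)
  obtain ⟨h3, h4⟩ := hG.abs_trilinear_sub_le (x := b - e) hy hz hp hq
  have h5 := hgeo (b - e)
  have h6 := hgeo' (b - e)
  have h7 : G y (b - e) (b - e) = G y b (b - e) - G y e (b - e) := by
    rw [(G y).map_sub]; rfl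
  have h8 : (G y - G z) e (b - e) = G y e (b - e) - G z e (b - e) := rfl
  have h9 : C * ‖y - z‖ * ‖e‖ * ‖b - e‖ ≤ C * ‖y - z‖ * A * ‖b - e‖ := by gcongr
  rw [h8] at h2
  have h2' := (abs_le.1 h2).1
  have h3' := (abs_le.1 h3).1
  have h4' := (abs_le.1 h4).2
  rw [h7] at h1
  linarith

/-- Uniform bounds for the velocities and accelerations, and a uniform Lipschitz bound for the
accelerations, of the unit speed geodesics in the domain of control. -/
theorem exists_geodesic_bounds (hG : MetricBounds G s lam C) : ∃ V A D : ℝ,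
    ∀ (c c' c'' : ℝ → E) (x ρ : ℝ),
    (∀ u ∈ Metric.ball x ρ, HasDerivAt c (c' u) u) →
    (∀ u ∈ Metric.ball x ρ, HasDerivAt c' (c'' u) u) →
    (∀ u ∈ Metric.ball x ρ, c u ∈ s) →
    (∀ u ∈ Metric.ball x ρ, G (c u) (c' u) (c' u) = 1) →
    (∀ u ∈ Metric.ball x ρ, ∀ w, G (c u) (c'' u) w + fderiv ℝ G (c u) (c' u) (c' u) w
      - fderiv ℝ G (c u) w (c' u) (c' u) / 2 = 0) →
    (∀ u ∈ Metric.ball x ρ, ‖c' u‖ ≤ V) ∧ (∀ u ∈ Metric.ball x ρ, ‖c'' u‖ ≤ A) ∧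
    (∀ u ∈ Metric.ball x ρ, ∀ v ∈ Metric.ball x ρ, ‖c' u - c' v‖ ≤ A * |u - v|) ∧
    (∀ u ∈ Metric.ball x ρ, ∀ v ∈ Metric.ball x ρ, ‖c'' u - c'' v‖ ≤ D * |u - v|) := by
  have hC := hG.nonneg
  have hl := hG.lam_pos
  obtain ⟨V, hV⟩ : ∃ V : ℝ, V = √(1 / lam) := ⟨_, rfl⟩
  have hV0 : 0 ≤ V := by rw [hV]; positivity
  obtain ⟨A, hA⟩ : ∃ A : ℝ, A = (3 / 2 * (C * V ^ 2)) / lam := ⟨_, rfl⟩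
  have hA0 : 0 ≤ A := by rw [hA]; positivity
  refine ⟨V, A, (C * V * A + 3 / 2 * (C * V * V ^ 2 + 2 * C * V * A)) / lam, ?_⟩
  intro c c' c'' x ρ hc hc' hcs hunit hgeo
  have b1 : ∀ u ∈ Metric.ball x ρ, ‖c' u‖ ≤ V := fun u hu => by
    rw [hV]; exact Real.le_sqrt_of_sq_le (hG.norm_sq_le (hcs u hu) (hunit u hu))
  have b2 : ∀ u ∈ Metric.ball x ρ, ‖c'' u‖ ≤ A := fun u hu => by
    rw [hA]; exact hG.norm_acceleration_le (hcs u hu) (b1 u hu) (hgeo u hu)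
  have b3 : ∀ u ∈ Metric.ball x ρ, ∀ v ∈ Metric.ball x ρ, ‖c u - c v‖ ≤ V * |u - v| :=
    fun u hu v hv => (convex_ball x ρ).norm_image_sub_le_of_norm_hasDerivWithin_le
      (fun w hw => (hc w hw).hasDerivWithinAt) b1 hv hu
  have b4 : ∀ u ∈ Metric.ball x ρ, ∀ v ∈ Metric.ball x ρ, ‖c' u - c' v‖ ≤ A * |u - v| :=
    fun u hu v hv => (convex_ball x ρ).norm_image_sub_le_of_norm_hasDerivWithin_le
      (fun w hw => (hc' w hw).hasDerivWithinAt) b2 hv hu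
  refine ⟨b1, b2, b4, fun u hu v hv => ?_⟩
  refine (hG.norm_acceleration_sub_le (hcs u hu) (hcs v hv) (b1 u hu) (b1 v hv) (b2 v hv)
    (hgeo u hu) (hgeo v hv)).trans ?_
  rw [div_mul_eq_mul_div _ lam]
  have e1 := b3 u hu v hv
  have e2 := b4 u hu v hv
  have f1 : C * ‖c u - c v‖ * A ≤ C * (V * |u - v|) * A := by gcongr
  have f2 : C * ‖c u - c v‖ * V ^ 2 ≤ C * (V * |u - v|) * V ^ 2 := by gcongr
  have f3 : 2 * C * V * ‖c' u - c' v‖ ≤ 2 * C * V * (A * |u - v|) := by gcongr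
  refine div_le_div_of_nonneg_right ?_ hl.le
  linarith

end MetricBounds

/-- A pointwise limit of functions with uniformly Lipschitz, pointwise convergent derivatives is
differentiable. -/
theorem hasDerivAt_of_tendsto_of_lipschitz {ι : Type*} {F : Filter ι} [F.NeBot]
    {f f' : ι → ℝ → E} {g g' : ℝ → E} {x ρ K : ℝ}
    (hd : ∀ᶠ i in F, ∀ u ∈ Metric.ball x ρ, HasDerivAt (f i) (f' i u) u)
    (hL : ∀ᶠ i in F, ∀ u ∈ Metric.ball x ρ, ∀ v ∈ Metric.ball x ρ,
      ‖f' i u - f' i v‖ ≤ K * |u - v|)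
    (hf : ∀ u ∈ Metric.ball x ρ, Tendsto (fun i => f i u) F (𝓝 (g u)))
    (hf' : ∀ u ∈ Metric.ball x ρ, Tendsto (fun i => f' i u) F (𝓝 (g' u))) :
    ∀ u ∈ Metric.ball x ρ, HasDerivAt g (g' u) u := by
  intro u hu
  -- A quadratic remainder bound with a uniform constant passes to pointwise limits, so uniform
  -- convergence is not needed.
  have key : ∀ v ∈ Metric.ball x ρ, ‖g v - g u - (v - u) • g' u‖ ≤ K * ‖v - u‖ ^ 2 := by
    intro v hv
    have hlim : Tendsto (fun i => ‖f i v - f i u - (v - u) • f' i u‖) F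
        (𝓝 ‖g v - g u - (v - u) • g' u‖) :=
      (((hf v hv).sub (hf u hu)).sub ((hf' u hu).const_smul (v - u))).norm
    refine le_of_tendsto hlim ?_
    filter_upwards [hd, hL] with i hi hi'
    have hsub : segment ℝ u v ⊆ Metric.ball x ρ := (convex_ball x ρ).segment_subset hu hv
    have hK : 0 ≤ K * |v - u| := (norm_nonneg _).trans (hi' v hv u hu)
    have h := (convex_segment (𝕜 := ℝ) u v).norm_image_sub_le_of_norm_hasDerivWithin_le
      (f := fun w => f i w - w • f' i u) (f' := fun w => f' i w - (1 : ℝ) • f' i u)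
      (C := K * |v - u|)
      (fun w hw => ((hi w (hsub hw)).sub ((hasDerivAt_id w).smul_const _)).hasDerivWithinAt)
      (fun w hw => ?_) (left_mem_segment ℝ u v) (right_mem_segment ℝ u v)
    · have e : f i v - v • f' i u - (f i u - u • f' i u) = f i v - f i u - (v - u) • f' i u := by
        rw [sub_smul]; abel
      rw [e] at h
      refine h.trans_eq ?_
      rw [Real.norm_eq_abs]; ring
    · rw [one_smul]
      refine (hi' w (hsub hw) u hu).trans ?_
      have h1 : |w - u| ≤ |v - u| := by
        have := norm_sub_le_of_mem_segment hw
        simpa [abs_sub_comm] using this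
      -- A negative `K` forces the segment to be a single point.
      rcases le_or_gt 0 K with hK0 | hK0
      · gcongr
      · have h2 : |v - u| = 0 := by
          refine le_antisymm ?_ (abs_nonneg _)
          by_contra! h3
          nlinarith
        have h3 : |w - u| = 0 := le_antisymm (h1.trans_eq h2) (abs_nonneg _)
        rw [h2, h3]
  rw [hasDerivAt_iff_isLittleO]
  have h1 : (fun v => g v - g u - (v - u) • g' u) =O[𝓝 u] fun v => ‖v - u‖ ^ 2 := by
    refine Asymptotics.IsBigO.of_bound K ?_
    filter_upwards [Metric.isOpen_ball.mem_nhds hu] with v hv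
    refine (key v hv).trans_eq ?_
    rw [Real.norm_of_nonneg (by positivity : 0 ≤ ‖v - u‖ ^ 2)]
  exact h1.trans_isLittleO (Asymptotics.isLittleO_pow_sub_sub u one_lt_two)

end Acceleration

/-! ### Limits of geodesics and uniform separation -/

section Limits

variable {E : Type*} [NormedAddCommGroup E] [NormedSpace ℝ E] [FiniteDimensional ℝ E]
  {M : Type*} [MetricSpace M] [ChartedSpace E M] [IsManifold 𝓘(ℝ, E) ∞ M]
  [RiemannianBundle (fun x : M => TangentSpace 𝓘(ℝ, E) x)]
  [IsContMDiffRiemannianBundle 𝓘(ℝ, E) ∞ E (fun x : M => TangentSpace 𝓘(ℝ, E) x)]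
  [IsRiemannianManifold 𝓘(ℝ, E) M]

theorem tendsto_clm_apply {ι X Y : Type*} [NormedAddCommGroup X] [NormedSpace ℝ X]
    [NormedAddCommGroup Y] [NormedSpace ℝ Y] {F : Filter ι} {f : ι → X →L[ℝ] Y} {g : ι → X}
    {f0 : X →L[ℝ] Y} {g0 : X} (hf : Tendsto f F (𝓝 f0)) (hg : Tendsto g F (𝓝 g0)) :
    Tendsto (fun i => f i (g i)) F (𝓝 (f0 g0)) :=
  (isBoundedBilinearMap_apply.continuous.tendsto (f0, g0)).comp (hf.prodMk_nhds hg)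

/-- In a chart, a pointwise limit of unit speed geodesics along an ultrafilter is of class `C²`,
has unit speed and solves the geodesic equation. -/
theorem exists_limit_in_chart {ι : Type*} {F : Ultrafilter ι} {g : ι → ℝ → M} {γ : ℝ → M}
    (hg : ∀ i, IsGeodesic E (g i)) (hu : ∀ i, IsUnitSpeed E (g i))
    (hlim : ∀ t, Tendsto (fun i => g i t) F (𝓝 (γ t))) (a : M) {t0 : ℝ}
    (ht0 : γ t0 ∈ (extChartAt 𝓘(ℝ, E) a).source) {c : ℝ → E}
    (hc : c = fun u => extChartAt 𝓘(ℝ, E) a (γ u)) :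
    ContDiffAt ℝ 2 c t0 ∧ chartMetric a (c t0) (deriv c t0) (deriv c t0) = 1 ∧
    ∀ w, chartMetric a (c t0) (deriv (deriv c) t0) w
      + fderiv ℝ (chartMetric (E := E) a) (c t0) (deriv c t0) (deriv c t0) w
      - fderiv ℝ (chartMetric (E := E) a) (c t0) w (deriv c t0) (deriv c t0) / 2 = 0 := by
  have := FiniteDimensional.proper_real E
  obtain ⟨r, hr, S, lam, C, hG, -, hS, hball⟩ := exists_ball_metricBounds (E := E) (γ t0) ht0
  obtain ⟨V, A, D, hbd⟩ := hG.exists_geodesic_bounds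
  have hρ : 0 < r / 2 := by positivity
  obtain ⟨k, hk⟩ : ∃ k : ι → ℝ → E, k = fun i u => extChartAt 𝓘(ℝ, E) a (g i u) := ⟨_, rfl⟩
  -- The curves are 1-Lipschitz, so over this time interval they stay where the metric is controlled
  -- as soon as they are close at `t0`.
  have hball' : ∀ᶠ i in (F : Filter ι), ∀ u ∈ Metric.ball t0 (r / 2),
      g i u ∈ Metric.ball (γ t0) r := by
    filter_upwards [hlim t0 (Metric.ball_mem_nhds _ hρ)] with i hi u hu'
    have h1 := dist_le_of_isUnitSpeed (hg i) (hu i) u t0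
    have h2 := dist_triangle (g i u) (g i t0) (γ t0)
    rw [mem_preimage, Metric.mem_ball] at hi
    rw [Metric.mem_ball, Real.dist_eq] at hu'
    rw [Metric.mem_ball]
    linarith
  have hγball : ∀ u ∈ Metric.ball t0 (r / 2), γ u ∈ Metric.ball (γ t0) r := by
    intro u hu'
    have h1 : dist (γ u) (γ t0) ≤ |u - t0| :=
      le_of_tendsto ((hlim u).dist (hlim t0))
        (Eventually.of_forall fun i => dist_le_of_isUnitSpeed (hg i) (hu i) u t0)
    rw [Metric.mem_ball, Real.dist_eq] at hu'
    rw [Metric.mem_ball]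
    linarith
  have hkc : ∀ u ∈ Metric.ball t0 (r / 2), Tendsto (fun i => k i u) F (𝓝 (c u)) := by
    intro u hu'
    rw [hk, hc]
    exact (continuousAt_extChartAt' (hball _ (hγball u hu')).1).tendsto.comp (hlim u)
  have hd1 : ∀ᶠ i in (F : Filter ι), ∀ u ∈ Metric.ball t0 (r / 2),
      HasDerivAt (k i) (deriv (k i) u) u := by
    filter_upwards [hball'] with i hi u hu'
    rw [hk]
    exact ((hg i).hasDerivAt a (hball _ (hi u hu')).1).1
  have hd2 : ∀ᶠ i in (F : Filter ι), ∀ u ∈ Metric.ball t0 (r / 2),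
      HasDerivAt (deriv (k i)) (deriv (deriv (k i)) u) u := by
    filter_upwards [hball'] with i hi u hu'
    rw [hk]
    exact ((hg i).hasDerivAt a (hball _ (hi u hu')).1).2
  have hunit : ∀ᶠ i in (F : Filter ι), ∀ u ∈ Metric.ball t0 (r / 2),
      chartMetric a (k i u) (deriv (k i) u) (deriv (k i) u) = 1 := by
    filter_upwards [hball'] with i hi u hu'
    have h1 := (hg i).norm_sq a (hball _ (hi u hu')).1
    rw [hu i u, one_pow] at h1
    rw [hk, chartMetric_apply, ← h1]
  have hgeo : ∀ᶠ i in (F : Filter ι), ∀ u ∈ Metric.ball t0 (r / 2), ∀ w,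
      chartMetric a (k i u) (deriv (deriv (k i)) u) w
      + fderiv ℝ (chartMetric (E := E) a) (k i u) (deriv (k i) u) (deriv (k i) u) w
      - fderiv ℝ (chartMetric (E := E) a) (k i u) w (deriv (k i) u) (deriv (k i) u) / 2 = 0 := by
    filter_upwards [hball'] with i hi u hu' w
    exact (hg i).equation a (hball _ (hi u hu')).1 (by rw [hk]) w
  have hbds := (hball'.and (hd1.and (hd2.and (hunit.and hgeo)))).mono
    fun i ⟨h0, h1, h2, h3, h4⟩ => hbd (k i) (deriv (k i)) (deriv (deriv (k i))) t0 (r / 2) h1 h2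
      (fun u hu' => by rw [hk]; exact (hball _ (h0 u hu')).2) h3 h4
  have hcpt : ∀ (f : ι → E) (B : ℝ), (∀ᶠ i in (F : Filter ι), ‖f i‖ ≤ B) →
      ∃ y, Tendsto f F (𝓝 y) := by
    intro f B hB
    have hmem : ∀ᶠ i in (F : Filter ι), f i ∈ Metric.closedBall (0 : E) B :=
      hB.mono fun i hi => by simpa using hi
    obtain ⟨y, -, hy⟩ := (isCompact_closedBall (0 : E) B).ultrafilter_le_nhds (F.map f)
      (le_principal_iff.2 hmem)
    exact ⟨y, hy⟩
  -- Bounded velocities converge along an ultrafilter. The value `0` outside the interval only makes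
  -- the chosen limit a total function.
  have hv : ∀ u, ∃ y, u ∈ Metric.ball t0 (r / 2) → Tendsto (fun i => deriv (k i) u) F (𝓝 y) := by
    intro u
    by_cases hu' : u ∈ Metric.ball t0 (r / 2)
    · obtain ⟨y, hy⟩ := hcpt (fun i => deriv (k i) u) V (hbds.mono fun i h => h.1 u hu')
      exact ⟨y, fun _ => hy⟩
    · exact ⟨0, fun h => absurd h hu'⟩
  have hb : ∀ u, ∃ y, u ∈ Metric.ball t0 (r / 2) →
      Tendsto (fun i => deriv (deriv (k i)) u) F (𝓝 y) := by
    intro u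
    by_cases hu' : u ∈ Metric.ball t0 (r / 2)
    · obtain ⟨y, hy⟩ := hcpt (fun i => deriv (deriv (k i)) u) A
        (hbds.mono fun i h => h.2.1 u hu')
      exact ⟨y, fun _ => hy⟩
    · exact ⟨0, fun h => absurd h hu'⟩
  choose v hv using hv
  choose b hb using hb
  have hcv : ∀ u ∈ Metric.ball t0 (r / 2), HasDerivAt c (v u) u :=
    hasDerivAt_of_tendsto_of_lipschitz hd1 (hbds.mono fun i h => h.2.2.1) hkc hv
  -- The Lipschitz bound on accelerations, read off from the equation, stands in for third
  -- derivatives of curves assumed only `C²`.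
  have hvb : ∀ u ∈ Metric.ball t0 (r / 2), HasDerivAt v (b u) u :=
    hasDerivAt_of_tendsto_of_lipschitz hd2 (hbds.mono fun i h => h.2.2.2) hv hb
  have hbL : ∀ u ∈ Metric.ball t0 (r / 2), ∀ u' ∈ Metric.ball t0 (r / 2),
      ‖b u - b u'‖ ≤ D * |u - u'| := fun u h u' h' =>
    le_of_tendsto ((hb u h).sub (hb u' h')).norm (hbds.mono fun i hi => hi.2.2.2 u h u' h')
  have hbc : ContinuousOn b (Metric.ball t0 (r / 2)) := by
    intro u h
    rw [ContinuousWithinAt, tendsto_iff_norm_sub_tendsto_zero]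
    have h1 : Tendsto (fun u' => D * |u' - u|) (𝓝[Metric.ball t0 (r / 2)] u) (𝓝 0) := by
      have : Continuous fun u' : ℝ => D * |u' - u| := by fun_prop
      simpa using (this.tendsto u).mono_left nhdsWithin_le_nhds
    exact squeeze_zero' (Eventually.of_forall fun _ => norm_nonneg _)
      (eventually_mem_nhdsWithin.mono fun u' h' => hbL u' h' u h) h1
  have ht0' : t0 ∈ Metric.ball t0 (r / 2) := Metric.mem_ball_self hρ
  have hnh : Metric.ball t0 (r / 2) ∈ 𝓝 t0 := Metric.ball_mem_nhds _ hρ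
  have hdc : deriv c =ᶠ[𝓝 t0] v := by
    filter_upwards [hnh] with u h using (hcv u h).deriv
  have e1 : deriv c t0 = v t0 := hdc.eq_of_nhds
  have e2 : deriv (deriv c) t0 = b t0 := by rw [hdc.deriv_eq, (hvb t0 ht0').deriv]
  have hct : c t0 ∈ (extChartAt 𝓘(ℝ, E) a).target := by
    rw [hc]; exact (extChartAt 𝓘(ℝ, E) a).map_source ht0
  have hop := isOpen_extChartAt_target (I := 𝓘(ℝ, E)) a
  have hGk : Tendsto (fun i => chartMetric (E := E) a (k i t0)) F (𝓝 (chartMetric a (c t0))) :=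
    (((contDiffOn_chartMetric a).continuousOn.continuousAt (hop.mem_nhds hct)).tendsto).comp
      (hkc t0 ht0')
  have hdGk : Tendsto (fun i => fderiv ℝ (chartMetric (E := E) a) (k i t0)) F
      (𝓝 (fderiv ℝ (chartMetric (E := E) a) (c t0))) :=
    ((((contDiffOn_chartMetric a).fderiv_of_isOpen (m := ∞) hop (by simp)).continuousOn.continuousAt
      (hop.mem_nhds hct)).tendsto).comp (hkc t0 ht0')
  refine ⟨?_, ?_, fun w => ?_⟩
  · have hv1 : ContDiffOn ℝ 1 v (Metric.ball t0 (r / 2)) := by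
      rw [show (1 : WithTop ℕ∞) = 0 + 1 by simp,
        contDiffOn_succ_iff_deriv_of_isOpen Metric.isOpen_ball]
      refine ⟨fun u h => (hvb u h).differentiableAt.differentiableWithinAt, by simp, ?_⟩
      exact contDiffOn_zero.2 (hbc.congr fun u h => (hvb u h).deriv)
    have hc2 : ContDiffOn ℝ 2 c (Metric.ball t0 (r / 2)) := by
      rw [show (2 : WithTop ℕ∞) = 1 + 1 by norm_num,
        contDiffOn_succ_iff_deriv_of_isOpen Metric.isOpen_ball]
      refine ⟨fun u h => (hcv u h).differentiableAt.differentiableWithinAt, by simp, ?_⟩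
      exact hv1.congr fun u h => (hcv u h).deriv
    exact hc2.contDiffAt hnh
  · rw [e1]
    refine tendsto_nhds_unique (tendsto_clm_apply (tendsto_clm_apply hGk (hv t0 ht0')) (hv t0 ht0')) ?_
    exact tendsto_const_nhds.congr' (hunit.mono fun i hi => (hi t0 ht0').symm)
  · rw [e1, e2]
    have h1 := tendsto_clm_apply (tendsto_clm_apply hGk (hb t0 ht0')) (tendsto_const_nhds (x := w))
    have h2 := tendsto_clm_apply (tendsto_clm_apply (tendsto_clm_apply hdGk (hv t0 ht0')) (hv t0 ht0'))
      (tendsto_const_nhds (x := w))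
    have h3 := tendsto_clm_apply (tendsto_clm_apply (tendsto_clm_apply hdGk
      (tendsto_const_nhds (x := w))) (hv t0 ht0')) (hv t0 ht0')
    refine tendsto_nhds_unique ((h1.add h2).sub (h3.div_const 2)) ?_
    exact tendsto_const_nhds.congr' (hgeo.mono fun i hi => (hi t0 ht0' w).symm)

/-- A pointwise limit of unit speed geodesics along an ultrafilter is a unit speed geodesic. -/
theorem isGeodesic_of_tendsto {ι : Type*} {F : Ultrafilter ι} {g : ι → ℝ → M} {γ : ℝ → M}
    (hg : ∀ i, IsGeodesic E (g i)) (hu : ∀ i, IsUnitSpeed E (g i))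
    (hlim : ∀ t, Tendsto (fun i => g i t) F (𝓝 (γ t))) : IsGeodesic E γ ∧ IsUnitSpeed E γ := by
  have hlip : ∀ s t, dist (γ s) (γ t) ≤ |s - t| := fun s t =>
    le_of_tendsto ((hlim s).dist (hlim t))
      (Eventually.of_forall fun i => dist_le_of_isUnitSpeed (hg i) (hu i) s t)
  have hcont : Continuous γ :=
    (LipschitzWith.of_dist_le_mul (K := 1) fun s t => by
      simpa [Real.dist_eq] using hlip s t).continuous
  have hsm : ContMDiff 𝓘(ℝ, ℝ) 𝓘(ℝ, E) 2 γ := fun t => by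
    rw [contMDiffAt_iff_target]
    exact ⟨hcont.continuousAt, (exists_limit_in_chart hg hu hlim (γ t)
      (mem_extChartAt_source _) rfl).1.contMDiffAt⟩
  refine ⟨⟨hsm, fun a t ht w => ?_⟩, fun t => ?_⟩
  · have h := (exists_limit_in_chart hg hu hlim a ht rfl).2.2 w
    have ht' := (extChartAt 𝓘(ℝ, E) a).map_source ht
    simp only
    rw [christoffelFirst_self a ht', ← add_sub_assoc]
    exact h
  · have ht : γ t ∈ (extChartAt 𝓘(ℝ, E) (γ t)).source := mem_extChartAt_source _
    obtain ⟨h1, h2, -⟩ := exists_limit_in_chart hg hu hlim (γ t) ht rfl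
    have h3 := norm_mfderiv_sq (γ t) (hsm.mdifferentiable (by simp) t) ht
      (h1.differentiableAt (by simp)).hasDerivAt
    rw [← chartMetric_apply, h2] at h3
    exact (pow_eq_one_iff_of_nonneg (norm_nonneg _) two_ne_zero).1 h3

/-- The points of a simple periodic curve determine their parameters modulo the period. -/
theorem coe_eq_coe_of_injOn {X : Type*} {γ : ℝ → X} {L : ℝ} (hL : 0 < L)
    (hper : Function.Periodic γ L) (hinj : InjOn γ (Ico 0 L)) {s t : ℝ} (h : γ s = γ t) :
    (s : AddCircle L) = t := by
  have h1 : ∀ x : ℝ, γ (toIcoMod hL 0 x) = γ x := fun x => hper.sub_zsmul_eq _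
  have h2 : ∀ x : ℝ, ((toIcoMod hL 0 x : ℝ) : AddCircle L) = x := fun x => by
    rw [toIcoMod, AddCircle.coe_sub, AddCircle.coe_zsmul, AddCircle.coe_period, smul_zero, sub_zero]
  have hmem : ∀ x : ℝ, toIcoMod hL 0 x ∈ Ico 0 L := fun x => by
    simpa using toIcoMod_mem_Ico hL 0 x
  rw [← h2 s, ← h2 t, hinj (hmem s) (hmem t) (by rw [h1, h1, h])]

/-- On a compact Riemannian manifold all of whose unit speed geodesics are simple of period `L`,
points of a geodesic whose parameters are at distance at least `r` modulo `L` are uniformly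
separated. -/
theorem exists_uniform_separation [CompactSpace M] {L : ℝ} (hL : 0 < L)
    (hSC : ∀ γ : ℝ → M, IsGeodesic E γ → IsUnitSpeed E γ →
      Function.Periodic γ L ∧ InjOn γ (Ico 0 L)) {r : ℝ} (hr : 0 < r) :
    ∃ ε > 0, ∀ γ : ℝ → M, IsGeodesic E γ → IsUnitSpeed E γ → ∀ s t : ℝ,
      r ≤ ‖((s - t : ℝ) : AddCircle L)‖ → ε ≤ dist (γ s) (γ t) := by
  by_contra! H
  -- Periodicity moves both parameters into a compact interval without changing the points or the
  -- classes modulo `L`.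
  have H' : ∀ n : ℕ, ∃ γ : ℝ → M, IsGeodesic E γ ∧ IsUnitSpeed E γ ∧ ∃ s ∈ Icc 0 L,
      ∃ t ∈ Icc 0 L, r ≤ ‖((s - t : ℝ) : AddCircle L)‖ ∧
        dist (γ s) (γ t) < 1 / ((n : ℝ) + 1) := by
    intro n
    obtain ⟨γ, h1, h2, s, t, h3, h4⟩ := H (1 / ((n : ℝ) + 1)) (by positivity)
    have hper := (hSC γ h1 h2).1
    have e1 : ∀ x : ℝ, γ (toIcoMod hL 0 x) = γ x := fun x => hper.sub_zsmul_eq _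
    have e2 : ∀ x : ℝ, ((toIcoMod hL 0 x : ℝ) : AddCircle L) = x := fun x => by
      rw [toIcoMod, AddCircle.coe_sub, AddCircle.coe_zsmul, AddCircle.coe_period, smul_zero,
        sub_zero]
    have hmem : ∀ x : ℝ, toIcoMod hL 0 x ∈ Icc 0 L := fun x => by
      have := toIcoMod_mem_Ico hL 0 x
      rw [zero_add] at this
      exact Ico_subset_Icc_self this
    refine ⟨γ, h1, h2, _, hmem s, _, hmem t, ?_, by rwa [e1, e1]⟩
    rwa [AddCircle.coe_sub, e2, e2, ← AddCircle.coe_sub]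
  choose g hg hu s hs t ht hst hdist using H'
  -- Along an ultrafilter all the values `g i t` converge at once in the compact `M`, so no
  -- subsequences are extracted.
  let F : Ultrafilter ℕ := hyperfilter ℕ
  have hF : (F : Filter ℕ) ≤ atTop := Nat.hyperfilter_le_atTop
  have hγ : ∀ t, ∃ x, Tendsto (fun i => g i t) F (𝓝 x) := fun t => by
    obtain ⟨x, -, hx⟩ := (isCompact_univ (X := M)).ultrafilter_le_nhds
      (F.map fun i => g i t) (by simp)
    exact ⟨x, hx⟩
  choose γ hγ using hγ
  obtain ⟨h1, h2⟩ := isGeodesic_of_tendsto hg hu hγ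
  have hcpt : ∀ p : ℕ → ℝ, (∀ n, p n ∈ Icc 0 L) → ∃ p0, Tendsto p F (𝓝 p0) := fun p hp => by
    have hmem : ∀ᶠ n in (F : Filter ℕ), p n ∈ Icc 0 L := Eventually.of_forall hp
    obtain ⟨p0, -, h⟩ := (isCompact_Icc (a := (0 : ℝ)) (b := L)).ultrafilter_le_nhds (F.map p)
      (le_principal_iff.2 hmem)
    exact ⟨p0, h⟩
  obtain ⟨s0, hs0⟩ := hcpt s hs
  obtain ⟨t0, ht0⟩ := hcpt t ht
  -- The common Lipschitz constant lets the evaluation point vary with the index.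
  have hmove : ∀ (p : ℕ → ℝ) (p0 : ℝ), Tendsto p F (𝓝 p0) →
      Tendsto (fun i => g i (p i)) F (𝓝 (γ p0)) := by
    intro p p0 hp
    rw [tendsto_iff_dist_tendsto_zero]
    have h3 : Tendsto (fun i => |p i - p0| + dist (g i p0) (γ p0)) F (𝓝 0) := by
      have := (hp.sub_const p0).abs.add (tendsto_iff_dist_tendsto_zero.1 (hγ p0))
      simpa using this
    refine squeeze_zero (fun _ => dist_nonneg) (fun i => ?_) h3
    refine (dist_triangle _ (g i p0) _).trans ?_
    gcongr
    exact dist_le_of_isUnitSpeed (hg i) (hu i) _ _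
  have h4 : Tendsto (fun n : ℕ => 1 / ((n : ℝ) + 1)) F (𝓝 0) :=
    tendsto_one_div_add_atTop_nhds_zero_nat.mono_left hF
  have h5 : γ s0 = γ t0 := dist_le_zero.1 (le_of_tendsto_of_tendsto
    ((hmove s s0 hs0).dist (hmove t t0 ht0)) h4 (Eventually.of_forall fun n => (hdist n).le))
  obtain ⟨hper, hinj⟩ := hSC γ h1 h2
  have h6 : ‖((s0 - t0 : ℝ) : AddCircle L)‖ = 0 := by
    rw [AddCircle.coe_sub, coe_eq_coe_of_injOn hL hper hinj h5, sub_self, norm_zero]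
  have h7 : Continuous fun x : ℝ => ‖(x : AddCircle L)‖ :=
    continuous_norm.comp (AddCircle.continuous_mk' L)
  have h8 : r ≤ ‖((s0 - t0 : ℝ) : AddCircle L)‖ :=
    ge_of_tendsto ((h7.tendsto _).comp (hs0.sub ht0)) (Eventually.of_forall hst)
  linarith

end Limits

/-! ### Smallest multiples on a circle -/

section CircleCombinatorics

/-- Labels may overlap: any choice of a label for each element is injective. -/
theorem encard_le_of_classes {α : Type*} {V : Set α} {c : ℕ} (P : α → Fin c → Prop)
    (hP : ∀ x ∈ V, ∃ i, P x i) (hinj : ∀ x ∈ V, ∀ y ∈ V, ∀ i, P x i → P y i → x = y) :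
    V.encard ≤ c := by
  choose f hf using hP
  have h : Function.Injective fun x : V => f x x.2 := fun x y hxy =>
    Subtype.ext (hinj x x.2 y y.2 (f x x.2) (hf x x.2) (by simp only at hxy; rw [hxy]; exact hf y y.2))
  have h1 := ENat.card_le_card_of_injective h
  simpa using h1

/-- The representative is the remainder after the nearest multiple of `L`; its sign tells on which
side of zero `u` lies. -/
theorem AddCircle.exists_coe_eq_abs_eq_norm {L : ℝ} (u : AddCircle L) :
    ∃ x : ℝ, (x : AddCircle L) = u ∧ |x| = ‖u‖ := by
  induction u using QuotientAddGroup.induction_on with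
  | H z =>
    refine ⟨z - round (L⁻¹ * z) • L, ?_, ?_⟩
    · rw [AddCircle.coe_sub, AddCircle.coe_zsmul, AddCircle.coe_period, smul_zero, sub_zero]
    · rw [zsmul_eq_mul]
      exact (AddCircle.norm_eq L).symm

/-- Among the multiples `k • τ` with `1 ≤ k ≤ m` and `n / 2 ≤ m ≤ n`, the smallest nonzero norm
takes at most three values. -/
theorem encard_least_norm_nsmul_le {L : ℝ} (τ : AddCircle L) (n : ℕ) :
    {ρ : ℝ | ∃ m, n ≤ 2 * m ∧ m ≤ n ∧
      IsLeast {a | ∃ k, 1 ≤ k ∧ k ≤ m ∧ 0 < ‖k • τ‖ ∧ a = ‖k • τ‖} ρ}.encard ≤ 3 := by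
  have hx : ∀ k : ℕ, ∃ x : ℝ, (x : AddCircle L) = k • τ ∧ |x| = ‖k • τ‖ := fun k =>
    AddCircle.exists_coe_eq_abs_eq_norm _
  choose x hx hxa using hx
  -- The first `k` attaining the minimum is a record: all earlier nonzero multiples are strictly
  -- longer.
  have hrec : ∀ ρ : ℝ, (∃ m, n ≤ 2 * m ∧ m ≤ n ∧
      IsLeast {a | ∃ k, 1 ≤ k ∧ k ≤ m ∧ 0 < ‖k • τ‖ ∧ a = ‖k • τ‖} ρ) →
      ∃ k, 1 ≤ k ∧ k ≤ n ∧ 0 < ρ ∧ ρ = ‖k • τ‖ ∧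
        ∀ j, 1 ≤ j → j < k → 0 < ‖j • τ‖ → ρ < ‖j • τ‖ := by
    classical
    rintro ρ ⟨m, -, hmn, ⟨k0, h1, h2, h3, h4⟩, hleast⟩
    have hex : ∃ k, 1 ≤ k ∧ k ≤ m ∧ ρ = ‖k • τ‖ := ⟨k0, h1, h2, h4⟩
    obtain ⟨e1, e2, e3⟩ := Nat.find_spec hex
    refine ⟨Nat.find hex, e1, e2.trans hmn, h4 ▸ h3, e3, fun j hj hjk hpos => ?_⟩
    refine lt_of_le_of_ne (hleast ⟨j, hj, (hjk.le.trans e2), hpos, rfl⟩) fun h => ?_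
    exact Nat.find_min hex hjk ⟨hj, hjk.le.trans e2, h⟩
  -- Two late records on the same side of zero would differ by a nonzero multiple of norm at most `ρ
  -- - ρ' < ρ`. Its index `k' - k` is below `k` because `k' ≤ n < 2 * k`, so the record at `k` would
  -- fail.
  have hsame : ∀ ρ ρ' : ℝ, ∀ k k' : ℕ, k < k' → n < 2 * k → k' ≤ n → 0 < ρ' → ρ = ‖k • τ‖ →
      ρ' = ‖k' • τ‖ → (∀ j, 1 ≤ j → j < k → 0 < ‖j • τ‖ → ρ < ‖j • τ‖) → ρ' < ρ →
      |x k' - x k| = ρ - ρ' → False := by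
    intro ρ ρ' k k' hkk hk hk' hρ' h1 h2 h3 hlt habs
    have e0 : (k' - k) • τ + k • τ = k' • τ := by rw [← add_nsmul, Nat.sub_add_cancel hkk.le]
    have e1 : (k' - k) • τ = ((x k' - x k : ℝ) : AddCircle L) := by
      rw [AddCircle.coe_sub, hx, hx, eq_sub_of_add_eq e0]
    have e2 : ‖(k' - k) • τ‖ ≤ ρ - ρ' := by
      rw [e1, ← habs]; exact QuotientAddGroup.norm_mk_le_norm
    have e3 : 0 < ‖(k' - k) • τ‖ := by
      refine lt_of_le_of_ne (norm_nonneg _) fun h => ?_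
      rw [norm_eq_zero.1 h.symm, zero_add] at e0
      rw [h1, h2, e0] at hlt
      exact lt_irrefl _ hlt
    have e4 := h3 (k' - k) (by omega) (by omega) e3
    linarith
  -- A record with `2 * k ≤ n` is available for every admissible `m`, so it gives one value; late
  -- records give at most one value on each side of zero.
  refine encard_le_of_classes (c := 3) (fun ρ i => ∃ k, (1 ≤ k ∧ k ≤ n ∧ 0 < ρ ∧ ρ = ‖k • τ‖ ∧
    ∀ j, 1 ≤ j → j < k → 0 < ‖j • τ‖ → ρ < ‖j • τ‖) ∧ ((i = 0 ∧ 2 * k ≤ n) ∨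
      (i = 1 ∧ n < 2 * k ∧ 0 ≤ x k) ∨ (i = 2 ∧ n < 2 * k ∧ x k < 0))) ?_ ?_
  · intro ρ hρ
    obtain ⟨k, hk⟩ := hrec ρ hρ
    rcases le_or_gt (2 * k) n with h | h
    · exact ⟨0, k, hk, Or.inl ⟨rfl, h⟩⟩
    · rcases le_or_gt 0 (x k) with h' | h'
      · exact ⟨1, k, hk, Or.inr (Or.inl ⟨rfl, h, h'⟩)⟩
      · exact ⟨2, k, hk, Or.inr (Or.inr ⟨rfl, h, h'⟩)⟩
  · have half : ∀ ρ ρ' : ℝ, ∀ k k' : ℕ, k < k' → n < 2 * k → k' ≤ n →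
        (0 < ρ ∧ ρ = ‖k • τ‖ ∧ ∀ j, 1 ≤ j → j < k → 0 < ‖j • τ‖ → ρ < ‖j • τ‖) →
        (0 < ρ' ∧ ρ' = ‖k' • τ‖ ∧ ∀ j, 1 ≤ j → j < k' → 0 < ‖j • τ‖ → ρ' < ‖j • τ‖) →
        ((0 ≤ x k ∧ 0 ≤ x k') ∨ (x k < 0 ∧ x k' < 0)) → False := by
      rintro ρ ρ' k k' hkk hk hk' ⟨h1, h2, h3⟩ ⟨h1', h2', h3'⟩ hsign
      have hlt : ρ' < ρ := by
        have := h3' k (by omega) hkk (h2 ▸ h1)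
        rwa [← h2] at this
      refine hsame ρ ρ' k k' hkk hk hk' h1' h2 h2' h3 hlt ?_
      rw [h2, h2', ← hxa, ← hxa] at hlt ⊢
      rcases hsign with ⟨s1, s2⟩ | ⟨s1, s2⟩
      · rw [abs_of_nonneg s1, abs_of_nonneg s2] at hlt ⊢
        rw [abs_of_neg (by linarith)]
        ring
      · rw [abs_of_neg s1, abs_of_neg s2] at hlt ⊢
        rw [abs_of_pos (by linarith)]
        ring
    rintro ρ ⟨m, hm, hmn, hleast⟩ ρ' ⟨m', hm', hmn', hleast'⟩ i
      ⟨k, ⟨k1, k2, k3, k4, k5⟩, hk⟩ ⟨k', ⟨k1', k2', k3', k4', k5'⟩, hk'⟩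
    have main : (2 * k ≤ n ∧ 2 * k' ≤ n) ∨ (n < 2 * k ∧ n < 2 * k' ∧
        ((0 ≤ x k ∧ 0 ≤ x k') ∨ (x k < 0 ∧ x k' < 0))) := by
      rcases hk with ⟨rfl, h⟩ | ⟨rfl, h, hs⟩ | ⟨rfl, h, hs⟩ <;>
      rcases hk' with ⟨e, h'⟩ | ⟨e, h', hs'⟩ | ⟨e, h', hs'⟩ <;>
      first
        | exact absurd e (by decide)
        | exact Or.inl ⟨h, h'⟩
        | exact Or.inr ⟨h, h', Or.inl ⟨hs, hs'⟩⟩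
        | exact Or.inr ⟨h, h', Or.inr ⟨hs, hs'⟩⟩
    rcases main with ⟨h, h'⟩ | ⟨h, h', hs⟩
    · refine le_antisymm ?_ ?_
      · exact hleast.2 ⟨k', k1', by omega, k4' ▸ k3', k4'⟩
      · exact hleast'.2 ⟨k, k1, by omega, k4 ▸ k3, k4⟩
    · rcases lt_trichotomy k k' with hlt | rfl | hlt
      · exact (half ρ ρ' k k' hlt h k2' ⟨k3, k4, k5⟩ ⟨k3', k4', k5'⟩ hs).elim
      · rw [k4, k4']
      · exact (half ρ' ρ k' k hlt h' k2 ⟨k3', k4', k5'⟩ ⟨k3, k4, k5⟩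
          (hs.imp And.symm And.symm)).elim

end CircleCombinatorics

/-! ### Nearest neighbor distances along a progression -/

section NearestNeighborCounting

variable {X : Type*} [MetricSpace X]

/-- A set enumerated by `N` indices has at most `N` nearest neighbor distances. -/
theorem encard_nearestNeighborDistances_le {S : Set X} {N : ℕ} (p : ℕ → X)
    (hS : ∀ x ∈ S, ∃ i < N, x = p i) : (nearestNeighborDistances S).encard ≤ N := by
  refine encard_le_of_classes (c := N)
    (fun r i => IsLeast ((fun y => dist (p i) y) '' (S \ {p i})) r) ?_ ?_
  · rintro r ⟨x, hx, hr⟩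
    obtain ⟨i, hi, rfl⟩ := hS x hx
    exact ⟨⟨i, hi⟩, hr⟩
  · exact fun r _ r' _ i h h' => h.unique h'

/-- A curve of period `L` that is isometric at small distances modulo `L`, and whose points are
uniformly separated at the other distances, has a bounded number of nearest neighbor distances
along its arithmetic progressions. -/
theorem exists_nearestNeighborDistances_bound {L r ε : ℝ} (hL : 0 < L) (hε : 0 < ε) (hεr : ε ≤ r) :
    ∃ K : ℕ, ∀ γ : ℝ → X,
      (∀ s t : ℝ, ‖((s - t : ℝ) : AddCircle L)‖ ≤ r →
        dist (γ s) (γ t) = ‖((s - t : ℝ) : AddCircle L)‖) →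
      (∀ s t : ℝ, r ≤ ‖((s - t : ℝ) : AddCircle L)‖ → ε ≤ dist (γ s) (γ t)) →
      ∀ (T : ℝ) (n : ℕ),
        (nearestNeighborDistances {p : X | ∃ i : ℕ, i ≤ n ∧ p = γ (i * T)}).encard ≤ K := by
  obtain ⟨N, hN⟩ := exists_nat_gt (L / ε)
  have hN0 : 0 < N := by
    have : (0 : ℝ) < N := lt_trans (by positivity) hN
    exact_mod_cast this
  -- Degenerate cases leave at most `2 * N` points, the main case at most 3 values; the sum covers
  -- both.
  refine ⟨2 * N + 3, fun γ h1 h2 T n => ?_⟩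
  have : Fact (0 < L) := ⟨hL⟩
  obtain ⟨τ, hτ⟩ : ∃ τ : AddCircle L, τ = (T : AddCircle L) := ⟨_, rfl⟩
  have hnsmul : ∀ k : ℕ, ((k * T : ℝ) : AddCircle L) = k • τ := fun k => by
    rw [hτ, ← AddCircle.coe_nsmul, nsmul_eq_mul]
  have hsub : ∀ i j : ℕ, j ≤ i → ((i * T - j * T : ℝ) : AddCircle L) = (i - j) • τ := by
    intro i j hij
    rw [AddCircle.coe_sub, hnsmul, hnsmul, sub_eq_iff_eq_add, ← add_nsmul, Nat.sub_add_cancel hij]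
  have hnorm : ∀ i j : ℕ, j ≤ i → ‖((i * T - j * T : ℝ) : AddCircle L)‖ = ‖(i - j) • τ‖ :=
    fun i j hij => by rw [hsub i j hij]
  have hnorm' : ∀ i j : ℕ, j ≤ i → ‖((j * T - i * T : ℝ) : AddCircle L)‖ = ‖(i - j) • τ‖ :=
    fun i j hij => by rw [← neg_sub, AddCircle.coe_neg, norm_neg, hsub i j hij]
  -- Dirichlet approximation: the norm is at most `L / (N + 1)`, which is below `ε`.
  obtain ⟨k, hk, hkN⟩ := AddCircle.exists_norm_nsmul_le τ hN0
  rw [Set.mem_Icc] at hk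
  have hkε : ‖k • τ‖ < ε := by
    refine hkN.trans_lt ?_
    rw [div_lt_iff₀ hε] at hN
    rw [div_lt_iff₀ (by positivity)]
    push_cast
    linarith
  rcases lt_or_ge n (2 * N) with hn | hn
  · refine (encard_nearestNeighborDistances_le (N := 2 * N) (fun i => γ (i * T)) ?_).trans ?_
    · rintro x ⟨i, hi, rfl⟩
      exact ⟨i, by omega, rfl⟩
    · exact_mod_cast (by omega : 2 * N ≤ 2 * N + 3)
  -- If `k • τ = 0`, the points repeat with index period `k ≤ N`.
  rcases (norm_nonneg (k • τ)).eq_or_lt with h0 | h0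
  · refine (encard_nearestNeighborDistances_le (N := 2 * N) (fun i => γ (i * T)) ?_).trans ?_
    · rintro x ⟨i, hi, rfl⟩
      refine ⟨i % k, (Nat.mod_lt _ (by omega)).trans_le (by omega), ?_⟩
      have h3 : ‖((i * T - (i % k : ℕ) * T : ℝ) : AddCircle L)‖ = 0 := by
        have e : i - i % k = (i / k) * k := by
          have := Nat.div_add_mod i k
          rw [mul_comm]; omega
        rw [hnorm i (i % k) (Nat.mod_le _ _), e, mul_nsmul', norm_eq_zero.1 h0.symm, nsmul_zero,
          norm_zero]
      have h4 := h1 (i * T) ((i % k : ℕ) * T) (by rw [h3]; linarith)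
      rw [h3] at h4
      exact dist_eq_zero.1 h4
    · exact_mod_cast (by omega : 2 * N ≤ 2 * N + 3)
  refine (encard_le_encard ?_).trans ((encard_least_norm_nsmul_le τ n).trans
    (by exact_mod_cast (by omega : 3 ≤ 2 * N + 3)))
  rintro ρ ⟨x, ⟨i, hi, rfl⟩, ⟨y, ⟨⟨j, hj, rfl⟩, hne⟩, hρ⟩, hleast⟩
  simp only at hρ
  -- a multiple of `τ` of small nonzero norm gives a neighbor
  have hnb : ∀ q : ℕ, 1 ≤ q → q ≤ max i (n - i) → 0 < ‖q • τ‖ → ‖q • τ‖ ≤ r → ρ ≤ ‖q • τ‖ := by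
    intro q hq1 hq hq0 hqr
    have hj' : ∃ j' : ℕ, j' ≤ n ∧ ‖((i * T - j' * T : ℝ) : AddCircle L)‖ = ‖q • τ‖ := by
      rcases le_max_iff.1 hq with h | h
      · exact ⟨i - q, by omega, by rw [hnorm i (i - q) (by omega)]; congr 2; omega⟩
      · exact ⟨i + q, by omega, by rw [hnorm' (i + q) i (by omega)]; congr 2; omega⟩
    obtain ⟨j', hj', hj''⟩ := hj'
    have hd := h1 (i * T) (j' * T) (hj''.trans_le hqr)
    rw [hj''] at hd
    rw [← hd]
    refine hleast ⟨_, ⟨⟨j', hj', rfl⟩, fun h => ?_⟩, rfl⟩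
    rw [mem_singleton_iff] at h
    rw [h, dist_self] at hd
    linarith
  -- As `2 * k ≤ 2 * N ≤ n`, one of `i - k` and `i + k` is an admissible index. Separation then
  -- forces the nearest neighbor to be close in parameter too.
  have hρε : ρ < ε := by
    refine (hnb k hk.1 ?_ h0 (hkε.le.trans hεr)).trans_lt hkε
    rw [le_max_iff]; omega
  have hlt : ‖((i * T - j * T : ℝ) : AddCircle L)‖ < r := by
    by_contra! h
    exact absurd (h2 _ _ h) (by rw [hρ]; exact not_le.2 hρε)
  have hρn := (h1 _ _ hlt.le).symm.trans hρ
  have hρ0 : 0 < ρ := by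
    rw [← hρ]
    exact dist_pos.2 fun h => hne h.symm
  -- Only the longer side of `i` matters: the norm does not see the sign of an index difference.
  refine ⟨max i (n - i), by omega, by omega, ?_, ?_⟩
  · have hij : i ≠ j := by rintro rfl; exact hne rfl
    rcases le_total j i with h | h
    · rw [hnorm i j h] at hρn
      exact ⟨i - j, by omega, le_max_of_le_left (by omega), by rwa [hρn], hρn.symm⟩
    · rw [hnorm' j i h] at hρn
      exact ⟨j - i, by omega, le_max_of_le_right (by omega), by rwa [hρn], hρn.symm⟩
  · rintro b ⟨q, hq1, hq, hq0, rfl⟩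
    rcases le_or_gt ‖q • τ‖ r with h | h
    · exact hnb q hq1 hq hq0 h
    · exact (hρε.le.trans hεr).trans h.le

end NearestNeighborCounting

/-! ### Reduction to unit speed and conclusion -/

section Rescaling

variable {E : Type*} [NormedAddCommGroup E] [NormedSpace ℝ E] [FiniteDimensional ℝ E]
  {M : Type*} [TopologicalSpace M] [ChartedSpace E M] [IsManifold 𝓘(ℝ, E) ∞ M]
  [RiemannianBundle (fun x : M => TangentSpace 𝓘(ℝ, E) x)]
  [IsContMDiffRiemannianBundle 𝓘(ℝ, E) ∞ E (fun x : M => TangentSpace 𝓘(ℝ, E) x)]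

/-- The acceleration and the Christoffel term both scale by `l ^ 2`. -/
theorem IsGeodesic.comp_mul_left {γ : ℝ → M} (hγ : IsGeodesic E γ) (l : ℝ) :
    IsGeodesic E (fun t => γ (l * t)) := by
  have hl : ContMDiff 𝓘(ℝ, ℝ) 𝓘(ℝ, ℝ) 2 fun t : ℝ => l * t :=
    (contDiff_const.mul contDiff_id).contMDiff
  refine ⟨hγ.1.comp hl, fun a t ht w => ?_⟩
  obtain ⟨c, hc⟩ : ∃ c : ℝ → E, c = fun u => extChartAt 𝓘(ℝ, E) a (γ u) := ⟨_, rfl⟩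
  have e0 : (fun s => extChartAt 𝓘(ℝ, E) a (γ (l * s))) = fun s => c (l * s) := by rw [hc]
  have e1 : deriv (fun s => c (l * s)) = fun s => l • deriv c (l * s) :=
    funext fun s => deriv_comp_mul_left l c s
  have e2 : deriv (fun s => l • deriv c (l * s)) t = l • l • deriv (deriv c) (l * t) := by
    rw [deriv_fun_const_smul_field, deriv_comp_mul_left]
  have h := hγ.equation a ht hc w
  have ht' : c (l * t) ∈ (extChartAt 𝓘(ℝ, E) a).target := by
    rw [hc]; exact (extChartAt 𝓘(ℝ, E) a).map_source ht
  have e3 : extChartAt 𝓘(ℝ, E) a (γ (l * t)) = c (l * t) := by rw [hc]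
  simp only [e0, e1, e2, e3]
  rw [christoffelFirst_self a ht', ← chartMetric_apply]
  simp only [map_smul, smul_apply, smul_eq_mul]
  linear_combination l ^ 2 * h

theorem IsGeodesic.norm_mfderiv_comp_mul_left {γ : ℝ → M} (hγ : IsGeodesic E γ) {l : ℝ}
    (hl : 0 ≤ l) (t : ℝ) : ‖mfderiv 𝓘(ℝ, ℝ) 𝓘(ℝ, E) (fun t => γ (l * t)) t (1 : ℝ)‖ =
      l * ‖mfderiv 𝓘(ℝ, ℝ) 𝓘(ℝ, E) γ (l * t) (1 : ℝ)‖ := by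
  have ht : γ (l * t) ∈ (extChartAt 𝓘(ℝ, E) (γ (l * t))).source := mem_extChartAt_source _
  have h1 := (hγ.comp_mul_left l).norm_sq (γ (l * t)) (t := t) ht
  have h2 := hγ.norm_sq (γ (l * t)) ht
  rw [deriv_comp_mul_left l (fun s => extChartAt 𝓘(ℝ, E) (γ (l * t)) (γ s)) t,
    ← chartMetric_apply] at h1
  simp only [map_smul, smul_apply, smul_eq_mul, chartMetric_apply] at h1
  rw [← h2] at h1
  refine (pow_left_inj₀ (norm_nonneg _) (mul_nonneg hl (norm_nonneg _)) two_ne_zero).1 ?_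
  rw [h1]
  ring

end Rescaling

/-- Shifting `t` by the multiple of `L` nearest to `s - t` turns the circle norm into a genuine
parameter difference. -/
theorem dist_eq_norm_addCircle {X : Type*} [MetricSpace X] {γ : ℝ → X} {L r : ℝ}
    (hper : Function.Periodic γ L) (h : ∀ s t, |s - t| ≤ r → dist (γ s) (γ t) = |s - t|) {s t : ℝ}
    (hst : ‖((s - t : ℝ) : AddCircle L)‖ ≤ r) :
    dist (γ s) (γ t) = ‖((s - t : ℝ) : AddCircle L)‖ := by
  have e : |s - (t + round (L⁻¹ * (s - t)) * L)| = ‖((s - t : ℝ) : AddCircle L)‖ := by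
    rw [AddCircle.norm_eq, sub_add_eq_sub_sub]
  have h1 : γ (t + round (L⁻¹ * (s - t)) * L) = γ t := hper.int_mul _ t
  rw [← h1, h _ _ (e.trans_le hst), e]

theorem mainTheorem4
    {E : Type*} [NormedAddCommGroup E] [NormedSpace ℝ E] [FiniteDimensional ℝ E]
    {M : Type*} [MetricSpace M] [CompactSpace M] [ChartedSpace E M] [IsManifold 𝓘(ℝ, E) ∞ M]
    [RiemannianBundle (fun x : M => TangentSpace 𝓘(ℝ, E) x)]
    [IsContMDiffRiemannianBundle 𝓘(ℝ, E) ∞ E (fun x : M => TangentSpace 𝓘(ℝ, E) x)]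
    [IsRiemannianManifold 𝓘(ℝ, E) M]
    (hSC : IsSC E M) :
    HasBoundedGeodesicCombinatorics E M := by
  obtain ⟨L, hL, hgeod⟩ := hSC
  obtain ⟨r, hr, hmin⟩ := exists_uniform_minimizing (E := E) (M := M)
  obtain ⟨ε, hε, hsep⟩ := exists_uniform_separation (E := E) (M := M) hL
    (fun γ h1 h2 => ⟨(hgeod γ h1 h2).1.1.2, (hgeod γ h1 h2).2⟩) hr
  obtain ⟨K, hK⟩ := exists_nearestNeighborDistances_bound (X := M) hL (lt_min hε hr)
    (min_le_right ε r)
  -- The extra 1 covers constant geodesics, bounded by their number of points.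
  refine ⟨K + 1, fun γ hγ T n => ?_⟩
  obtain ⟨v, hv0, hv⟩ := hγ.exists_speed
  rcases hv0.eq_or_lt with rfl | hv0
  · have hconst : ∀ s, γ s = γ 0 := fun s => by
      have h := dist_le_of_norm_mfderiv_eq (hγ.1.of_le (by norm_num)) hv s 0
      rw [zero_mul] at h
      exact dist_le_zero.1 h
    refine (encard_nearestNeighborDistances_le (N := 1) (fun _ => γ 0) ?_).trans ?_
    · rintro x ⟨i, -, rfl⟩
      exact ⟨0, one_pos, hconst _⟩
    · exact_mod_cast (by omega : 1 ≤ K + 1)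
  · have hg : IsGeodesic E (fun t => γ (v⁻¹ * t)) := hγ.comp_mul_left _
    have hu : IsUnitSpeed E (fun t => γ (v⁻¹ * t)) := fun t => by
      rw [hγ.norm_mfderiv_comp_mul_left (inv_nonneg.2 hv0.le), hv, inv_mul_cancel₀ hv0.ne']
    -- Slowing time by `v` and stretching the step to `v * T` gives the same points.
    have h := hK (fun t => γ (v⁻¹ * t))
      (fun s t hst => dist_eq_norm_addCircle (hgeod _ hg hu).1.1.2 (hmin _ hg hu) hst)
      (fun s t hst => (min_le_left ε r).trans (hsep _ hg hu s t hst)) (v * T) n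
    have e : ∀ i : ℕ, v⁻¹ * (i * (v * T)) = i * T := fun i => by field_simp
    simp only [e] at h
    exact h.trans (by exact_mod_cast Nat.le_succ K)
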